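/- Theorem. There are an algorithm and a polynomial $p$ such that, given a graph $G$ on the vertex set $\{0,\dots,n-1\}$ and an irredundant clique-width expression $\psi$ of $G$ of width $\mathrm{cw}$, the algorithm computes, for every integer $\ell \in [0,n/2]$, the number of induced matchings of $G$ with exactly $\ell$ edges, in time at most $3^{\mathrm{cw}} \cdot p(N)$, where $N$ is the length in bits of the input $(G,\psi)$; that is, in time $\mathcal{O}^*(3^{\mathrm{cw}})$. The algorithm is a program of a random access machine with logarithmic cost measure, i.e. every arithmetic operation and every memory access is charged according to the bit lengths of the numbers and addresses involved. Here a matching $M$ of $G$ is a set of edges such that every vertex is incident with at most one edge of $M$, and it is induced if the subgraph of $G$ induced by the endpoints of the edges of $M$ is $1$-regular. A clique-width expression is built from the operations $i(v)$ (a single vertex $v$ of label $i$), $H_1 \oplus H_2$ (the union of two vertex-disjoint labeled graphs), $\eta_{i,j}(H)$ with $i \neq j$ (adding all edges between vertices of label $i$ and vertices of label $j$) and $\rho_{i\to j}(H)$ with $i \ne j$ (changing every label $i$ to $j$); it is an expression of $G$ if the graph that it generates, without its labels, is $G$; its width is the number of different labels that occur in it; and it is irredundant if, whenever $\eta_{i,j}$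 is applied to a labeled graph $H$, there is no edge of $H$ between a vertex of label $i$ and a vertex of label $j$. -/

import Mathlib

/-! ### Random access machines with logarithmic cost

A machine has registers `reg 0, reg 1, …` (addressed directly by the program, so that a fixed
program uses only finitely many of them) and a memory `mem 0, mem 1, …` (addressed indirectly,
through computed addresses). Every cell holds a natural number.  Programs are `while` programs, and
an operation is charged by the binary lengths `Nat.size` of the numbers it handles. -/

namespace RAM

/-- Arithmetic operations of the machine. Subtraction is truncated, and `x / 0 = 0`,
`x % 0 = x`. -/
inductive Op
  | add
  | sub
  | mul
  | div
  | mod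

def Op.apply : Op → ℕ → ℕ → ℕ
  | .add, x, y => x + y
  | .sub, x, y => x - y
  | .mul, x, y => x * y
  | .div, x, y => x / y
  | .mod, x, y => x % y

/-- Expressions: constants, register contents, contents of the memory cell whose address is the
value of an expression, and arithmetic operations. -/
inductive Expr
  | const (k : ℕ)
  | reg (r : ℕ)
  | load (a : Expr)
  | op (o : Op) (a b : Expr)

/-- Programs. Tests in `ite` and `loop` (a `while` loop) succeed if the value is nonzero. -/
inductive Prog
  | skip
  | assign (r : ℕ) (e : Expr)
  | store (a e : Expr)
  | seq (p q : Prog)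
  | ite (e : Expr) (p q : Prog)
  | loop (e : Expr) (p : Prog)

/-- A machine state: the contents of the registers and of the memory. -/
structure State where
  reg : ℕ → ℕ
  mem : ℕ → ℕ

/-- The value of an expression. -/
def Expr.eval (s : State) : Expr → ℕ
  | .const k => k
  | .reg r => s.reg r
  | .load a => s.mem (a.eval s)
  | .op o a b => o.apply (a.eval s) (b.eval s)

/-- The time for evaluating an expression. An arithmetic operation on numbers of `k` and `l` bits is
charged `(k + 1) * (l + 1)`; a memory access is charged the bit lengths of the address and of the
content of the cell, plus one. -/
def Expr.cost (s : State) : Expr → ℕ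
  | .const k => Nat.size k + 1
  | .reg r => Nat.size (s.reg r) + 1
  | .load a => a.cost s + Nat.size (a.eval s) + Nat.size (s.mem (a.eval s)) + 1
  | .op _ a b =>
      a.cost s + b.cost s + (Nat.size (a.eval s) + 1) * (Nat.size (b.eval s) + 1)

/-- `Exec p s s' t`: started in the state `s`, the program `p` halts in the state `s'` after time
`t`. -/
inductive Exec : Prog → State → State → ℕ → Prop
  | skip (s : State) : Exec .skip s s 1
  | assign (s : State) (r : ℕ) (e : Expr) :
      Exec (.assign r e) s ⟨Function.update s.reg r (e.eval s), s.mem⟩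
        (e.cost s + Nat.size (e.eval s) + 1)
  | store (s : State) (a e : Expr) :
      Exec (.store a e) s ⟨s.reg, Function.update s.mem (a.eval s) (e.eval s)⟩
        (a.cost s + e.cost s + Nat.size (a.eval s) + Nat.size (e.eval s) + 1)
  | seq {s s' s'' : State} {p q : Prog} {t t' : ℕ} (hp : Exec p s s' t) (hq : Exec q s' s'' t') :
      Exec (.seq p q) s s'' (t + t')
  | ite_true {s s' : State} {e : Expr} {p q : Prog} {t : ℕ} (he : e.eval s ≠ 0)
      (hp : Exec p s s' t) : Exec (.ite e p q) s s' (e.cost s + 1 + t)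
  | ite_false {s s' : State} {e : Expr} {p q : Prog} {t : ℕ} (he : e.eval s = 0)
      (hq : Exec q s s' t) : Exec (.ite e p q) s s' (e.cost s + 1 + t)
  | loop_done {s : State} {e : Expr} {p : Prog} (he : e.eval s = 0) :
      Exec (.loop e p) s s (e.cost s + 1)
  | loop_step {s s' s'' : State} {e : Expr} {p : Prog} {t t' : ℕ} (he : e.eval s ≠ 0)
      (hp : Exec p s s' t) (hl : Exec (.loop e p) s' s'' t') :
      Exec (.loop e p) s s'' (e.cost s + 1 + t + t')

/-- The start state on an input `l`: the input stands in the memory cells `0, …, l.length - 1`,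
register `0` holds its length, and all other cells hold `0`. -/
def start (l : List ℕ) : State where
  reg := fun r => if r = 0 then l.length else 0
  mem := fun a => l.getD a 0

/-- The length of an input in bits, with one extra symbol per number. -/
def bitLength (l : List ℕ) : ℕ := (l.map fun k => Nat.size k + 1).sum

end RAM

/-! ### Clique-width expressions -/

/-- A labeled graph whose vertices are taken from `V`. The values of `lab` outside `verts` are
irrelevant. -/
structure LabeledGraph (V : Type*) where
  verts : Finset V
  graph : SimpleGraph V
  mem_verts : ∀ ⦃u v : V⦄, graph.Adj u v → u ∈ verts
  lab : V → ℕ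

/-- Clique-width expressions with labels from `ℕ`: `single i v` is `i(v)`, `union` is the disjoint
union, `join i j` is `η_{i,j}`, and `relabel i j` is `ρ_{i → j}`. -/
inductive CWExpr (V : Type*)
  | single (i : ℕ) (v : V)
  | union (φ ψ : CWExpr V)
  | join (i j : ℕ) (φ : CWExpr V)
  | relabel (i j : ℕ) (φ : CWExpr V)

namespace CWExpr

variable {V : Type*} [DecidableEq V]

/-- The labeled graph that is generated by an expression. -/
def eval : CWExpr V → LabeledGraph V
  | single i v =>
      { verts := {v}
        graph := ⊥
        mem_verts := fun _ _ h => h.elim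
        lab := fun _ => i }
  | union φ ψ =>
      { verts := φ.eval.verts ∪ ψ.eval.verts
        graph := φ.eval.graph ⊔ ψ.eval.graph
        mem_verts := fun _ _ h => Finset.mem_union.2
          (h.imp (fun h => φ.eval.mem_verts h) (fun h => ψ.eval.mem_verts h))
        lab := fun v => if v ∈ φ.eval.verts then φ.eval.lab v else ψ.eval.lab v }
  | join i j φ =>
      { verts := φ.eval.verts
        graph := φ.eval.graph ⊔ SimpleGraph.fromRel fun u v =>
          (u ∈ φ.eval.verts ∧ φ.eval.lab u = i) ∧ (v ∈ φ.eval.verts ∧ φ.eval.lab v = j)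
        mem_verts := fun _ _ h => h.elim (fun h => φ.eval.mem_verts h)
          (fun h => h.2.elim (fun h => h.1.1) (fun h => h.2.1))
        lab := φ.eval.lab }
  | relabel i j φ =>
      { verts := φ.eval.verts
        graph := φ.eval.graph
        mem_verts := φ.eval.mem_verts
        lab := fun v => if φ.eval.lab v = i then j else φ.eval.lab v }

/-- The expression is well formed: unions are unions of vertex-disjoint graphs, and joins and
relabelings use two distinct labels. -/
def WellFormed : CWExpr V → Prop
  | single _ _ => True
  | union φ ψ => φ.WellFormed ∧ ψ.WellFormed ∧ Disjoint φ.eval.verts ψ.eval.verts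
  | join i j φ => φ.WellFormed ∧ i ≠ j
  | relabel i j φ => φ.WellFormed ∧ i ≠ j

/-- The expression is irredundant: whenever `η_{i,j}` is applied to a labeled graph, that graph has
no edge between a vertex of label `i` and a vertex of label `j`. -/
def Irredundant : CWExpr V → Prop
  | single _ _ => True
  | union φ ψ => φ.Irredundant ∧ ψ.Irredundant
  | join i j φ => φ.Irredundant ∧
      ∀ u v : V, φ.eval.lab u = i → φ.eval.lab v = j → ¬ φ.eval.graph.Adj u v
  | relabel _ _ φ => φ.Irredundant

/-- The labels that occur in an expression. -/
def labels : CWExpr V → Finset ℕ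
  | single i _ => {i}
  | union φ ψ => φ.labels ∪ ψ.labels
  | join i j φ => {i, j} ∪ φ.labels
  | relabel i j φ => {i, j} ∪ φ.labels

/-- The width of an expression is the number of different labels that it uses. -/
def width (ψ : CWExpr V) : ℕ := ψ.labels.card

/-- `ψ` is a (well-formed) clique-width expression of the graph `G` on the vertex set `V`. -/
def Describes [Fintype V] (ψ : CWExpr V) (G : SimpleGraph V) : Prop :=
  ψ.WellFormed ∧ ψ.eval.verts = Finset.univ ∧ ψ.eval.graph = G

/-- An expression written in postfix notation, three numbers for every operation. -/
def encode {n : ℕ} : CWExpr (Fin n) → List ℕ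
  | single i v => [0, i, v]
  | union φ ψ => φ.encode ++ ψ.encode ++ [1, 0, 0]
  | join i j φ => φ.encode ++ [2, i, j]
  | relabel i j φ => φ.encode ++ [3, i, j]

end CWExpr

open Classical in
/-- The input `(G, ψ)`: the number of vertices, the adjacency matrix of `G` row by row, and the
expression `ψ`. -/
noncomputable def encodeInput {n : ℕ} (G : SimpleGraph (Fin n)) (ψ : CWExpr (Fin n)) : List ℕ :=
  [n] ++ ((List.finRange n).flatMap fun u =>
    (List.finRange n).map fun v => if G.Adj u v then 1 else 0) ++ ψ.encode

/-! ### Induced matchings -/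

namespace SimpleGraph

variable {V : Type*}

/-- The set `V_M` of the vertices that are incident with an edge in `M`. -/
def edgeEnds (M : Finset (Sym2 V)) : Set V := {v | ∃ e ∈ M, v ∈ e}

/-- `M` is a matching of `G`: a set of edges of `G` such that every vertex is incident with at most
one edge in `M`. -/
def IsEdgeMatching (G : SimpleGraph V) (M : Finset (Sym2 V)) : Prop :=
  (∀ e ∈ M, e ∈ G.edgeSet) ∧ ∀ v : V, ∀ e ∈ M, ∀ f ∈ M, v ∈ e → v ∈ f → e = f

/-- `M` is an induced matching of `G`: a matching such that the subgraph `G[V_M]` of `G` is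
`1`-regular. -/
def IsInducedMatching (G : SimpleGraph V) (M : Finset (Sym2 V)) : Prop :=
  G.IsEdgeMatching M ∧ ∀ v ∈ edgeEnds M, ∃! w : V, w ∈ edgeEnds M ∧ G.Adj v w

/-- The number of induced matchings of `G` with exactly `l` edges. -/
noncomputable def numInducedMatchings (G : SimpleGraph V) (l : ℕ) : ℕ :=
  {M : Finset (Sym2 V) | G.IsInducedMatching M ∧ M.card = l}.ncard

end SimpleGraph

/-! ### Executions of loop-free programs, and of loops -/

namespace RAM

/-- All registers and memory cells hold numbers of at most `b` bits. -/
def State.Bounded (s : State) (b : ℕ) : Prop :=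
  (∀ r, Nat.size (s.reg r) ≤ b) ∧ ∀ a, Nat.size (s.mem a) ≤ b

theorem State.Bounded.mono {s : State} {b c : ℕ} (h : s.Bounded b) (hbc : b ≤ c) :
    s.Bounded c :=
  ⟨fun r => (h.1 r).trans hbc, fun a => (h.2 a).trans hbc⟩

theorem size_le_of_le {m k b : ℕ} (h : m ≤ k) (hk : Nat.size k ≤ b) : Nat.size m ≤ b :=
  (Nat.size_le_size h).trans hk

theorem Op.size_apply_le (o : Op) {x y b : ℕ} (hx : Nat.size x ≤ b) (hy : Nat.size y ≤ b) :
    Nat.size (o.apply x y) ≤ 2 * b + 1 := by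
  have hx' := Nat.size_le.1 hx
  have hy' := Nat.size_le.1 hy
  cases o
  · refine Nat.size_le.2 ?_
    have : 2 ^ (b + 1) ≤ 2 ^ (2 * b + 1) := Nat.pow_le_pow_right (by norm_num) (by omega)
    simp only [Op.apply]
    rw [pow_succ] at this
    omega
  · exact (size_le_of_le (Nat.sub_le _ _) hx).trans (by omega)
  · refine Nat.size_le.2 ?_
    simp only [Op.apply]
    calc x * y < 2 ^ b * 2 ^ b := Nat.mul_lt_mul'' hx' hy'
      _ = 2 ^ (2 * b) := by rw [two_mul, pow_add]
      _ ≤ _ := Nat.pow_le_pow_right (by norm_num) (by omega)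
  · exact (size_le_of_le (Nat.div_le_self _ _) hx).trans (by omega)
  · exact (size_le_of_le (Nat.mod_le _ _) hx).trans (by omega)

/-- An expression consists of a fixed number of operations, and each of them at most doubles the bit
length, up to one bit. The constant depends only on the expression. -/
theorem Expr.exists_cost_le (e : Expr) : ∃ C, ∀ (s : State) (b : ℕ), s.Bounded b →
    Nat.size (e.eval s) ≤ C * (b + 1) ∧ e.cost s ≤ C * (b + 1) ^ 2 := by
  induction e with
  | const k =>
    refine ⟨Nat.size k + 1, fun s b _ => ⟨?_, ?_⟩⟩
    · simp only [Expr.eval]; nlinarith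
    · simp only [Expr.cost]; exact Nat.le_mul_of_pos_right _ (by positivity)
  | reg r =>
    refine ⟨1, fun s b h => ⟨?_, ?_⟩⟩
    · simp only [Expr.eval]; have := h.1 r; omega
    · simp only [Expr.cost]; have := h.1 r; nlinarith
  | load a ih =>
    obtain ⟨C, hC⟩ := ih
    refine ⟨2 * C + 1, fun s b h => ⟨?_, ?_⟩⟩
    · simp only [Expr.eval]; have := h.2 (a.eval s); nlinarith
    · simp only [Expr.cost]
      obtain ⟨h1, h2⟩ := hC s b h
      have := h.2 (a.eval s)
      have : C * (b + 1) ≤ C * (b + 1) ^ 2 :=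
        Nat.mul_le_mul_left _ (Nat.le_self_pow (by norm_num) _)
      nlinarith
  | op o a c iha ihc =>
    obtain ⟨C, hC⟩ := iha
    obtain ⟨D, hD⟩ := ihc
    refine ⟨C + D + (C + 1) * (D + 1) + 2 * (C + D) + 1, fun s b h => ?_⟩
    obtain ⟨h1, h2⟩ := hC s b h
    obtain ⟨h3, h4⟩ := hD s b h
    constructor
    · have := o.size_apply_le (b := (C + D) * (b + 1))
        (h1.trans (Nat.mul_le_mul_right _ (Nat.le_add_right C D)))
        (h3.trans (Nat.mul_le_mul_right _ (Nat.le_add_left D C)))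
      refine this.trans ?_
      have : (2 * (C + D) + 1) * (b + 1) ≤
          (C + D + (C + 1) * (D + 1) + 2 * (C + D) + 1) * (b + 1) :=
        Nat.mul_le_mul_right _ (by omega)
      nlinarith
    · simp only [Expr.cost]
      have h5 : (Nat.size (a.eval s) + 1) * (Nat.size (c.eval s) + 1) ≤
          ((C + 1) * (b + 1)) * ((D + 1) * (b + 1)) :=
        Nat.mul_le_mul (by nlinarith) (by nlinarith)
      have h6 : 0 ≤ (2 * (C + D) + 1) * (b + 1) ^ 2 := Nat.zero_le _
      nlinarith

/-- The program contains no loop. -/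
def Prog.LoopFree : Prog → Prop
  | .seq p q => p.LoopFree ∧ q.LoopFree
  | .ite _ p q => p.LoopFree ∧ q.LoopFree
  | .loop _ _ => False
  | _ => True

/-- The final state of a loop-free program. -/
def Prog.run : Prog → State → State
  | .skip, s => s
  | .assign r e, s => ⟨Function.update s.reg r (e.eval s), s.mem⟩
  | .store a e, s => ⟨s.reg, Function.update s.mem (a.eval s) (e.eval s)⟩
  | .seq p q, s => q.run (p.run s)
  | .ite e p q, s => if e.eval s ≠ 0 then p.run s else q.run s
  | .loop _ _, s => s

/-- The program `p` leads from `s` to `s'` within time `t`. -/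
def ExecLE (p : Prog) (s s' : State) (t : ℕ) : Prop :=
  ∃ u ≤ t, Exec p s s' u

theorem ExecLE.seq {p q : Prog} {s s' s'' : State} {t t' : ℕ} (hp : ExecLE p s s' t)
    (hq : ExecLE q s' s'' t') : ExecLE (.seq p q) s s'' (t + t') := by
  obtain ⟨u, hu, h⟩ := hp
  obtain ⟨u', hu', h'⟩ := hq
  exact ⟨u + u', by omega, .seq h h'⟩

theorem ExecLE.mono {p : Prog} {s s' : State} {t t' : ℕ} (h : ExecLE p s s' t) (ht : t ≤ t') :
    ExecLE p s s' t' := by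
  obtain ⟨u, hu, h⟩ := h
  exact ⟨u, hu.trans ht, h⟩

/-- This reduces the time analysis to counting iterations and bounding the states between them. The
bound `b` itself is not preserved by a run, so a loop invariant has to re-establish it after every
iteration. -/
theorem Prog.exists_run_le (p : Prog) (hp : p.LoopFree) : ∃ C, ∀ (s : State) (b : ℕ),
    s.Bounded b → (p.run s).Bounded (C * (b + 1)) ∧ ExecLE p s (p.run s) (C * (b + 1) ^ 2) := by
  induction p with
  | skip =>
    refine ⟨1, fun s b h => ⟨h.mono (by omega), 1, ?_, .skip s⟩⟩
    rw [one_mul]; exact Nat.one_le_pow _ _ (by omega)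
  | assign r e =>
    obtain ⟨C, hC⟩ := e.exists_cost_le
    refine ⟨2 * C + 1, fun s b h => ?_⟩
    obtain ⟨h1, h2⟩ := hC s b h
    refine ⟨⟨fun r' => ?_, fun a => ?_⟩, _, ?_, .assign s r e⟩
    · simp only [Prog.run, Function.update_apply]
      split_ifs
      · nlinarith
      · have := h.1 r'; nlinarith
    · have := h.2 a
      simp only [Prog.run]; nlinarith
    · have : C * (b + 1) ≤ C * (b + 1) ^ 2 :=
        Nat.mul_le_mul_left _ (Nat.le_self_pow (by norm_num) _)
      nlinarith
  | store a e =>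
    obtain ⟨C, hC⟩ := e.exists_cost_le
    obtain ⟨D, hD⟩ := a.exists_cost_le
    refine ⟨2 * C + 2 * D + 1, fun s b h => ?_⟩
    obtain ⟨h1, h2⟩ := hC s b h
    obtain ⟨h3, h4⟩ := hD s b h
    refine ⟨⟨fun r' => ?_, fun x => ?_⟩, _, ?_, .store s a e⟩
    · have := h.1 r'
      simp only [Prog.run]; nlinarith
    · simp only [Prog.run, Function.update_apply]
      split_ifs
      · nlinarith
      · have := h.2 x; nlinarith
    · have h5 : C * (b + 1) ≤ C * (b + 1) ^ 2 :=
        Nat.mul_le_mul_left _ (Nat.le_self_pow (by norm_num) _)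
      have h6 : D * (b + 1) ≤ D * (b + 1) ^ 2 :=
        Nat.mul_le_mul_left _ (Nat.le_self_pow (by norm_num) _)
      nlinarith
  | seq p q ihp ihq =>
    obtain ⟨C, hC⟩ := ihp hp.1
    obtain ⟨D, hD⟩ := ihq hp.2
    refine ⟨C + D * (C + 1) ^ 2, fun s b h => ?_⟩
    obtain ⟨h1, h2⟩ := hC s b h
    obtain ⟨h3, h4⟩ := hD _ _ h1
    have h5 : C * (b + 1) + 1 ≤ (C + 1) * (b + 1) := by nlinarith
    refine ⟨h3.mono ?_, (h2.seq h4).mono ?_⟩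
    · calc D * (C * (b + 1) + 1) ≤ D * ((C + 1) ^ 2 * (b + 1)) :=
            Nat.mul_le_mul_left _ (h5.trans (Nat.mul_le_mul_right _
              (Nat.le_self_pow (by norm_num) _)))
        _ ≤ _ := by nlinarith
    · calc C * (b + 1) ^ 2 + D * (C * (b + 1) + 1) ^ 2
          ≤ C * (b + 1) ^ 2 + D * ((C + 1) * (b + 1)) ^ 2 := by gcongr
        _ = _ := by ring
  | ite e p q ihp ihq =>
    obtain ⟨B, hB⟩ := e.exists_cost_le
    obtain ⟨C, hC⟩ := ihp hp.1
    obtain ⟨D, hD⟩ := ihq hp.2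
    refine ⟨B + C + D + 1, fun s b h => ?_⟩
    obtain ⟨h1, h2⟩ := hB s b h
    have h0 : 1 ≤ (b + 1) ^ 2 := Nat.one_le_pow _ _ (by omega)
    have hle : ∀ x ≤ B + C + D + 1, x * (b + 1) ≤ (B + C + D + 1) * (b + 1) :=
      fun x hx => Nat.mul_le_mul_right _ hx
    by_cases he : e.eval s = 0
    · obtain ⟨h3, u, hu, h4⟩ := hD s b h
      simp only [Prog.run, he, ne_eq, not_true_eq_false, if_false]
      exact ⟨h3.mono (hle _ (by omega)), _, by nlinarith, .ite_false he h4⟩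
    · obtain ⟨h3, u, hu, h4⟩ := hC s b h
      simp only [Prog.run, he, ne_eq, not_false_eq_true, if_true]
      exact ⟨h3.mono (hle _ (by omega)), _, by nlinarith, .ite_true he h4⟩
  | loop e p => exact hp.elim

/-- Some iterations of the loop with the test `e` and the body `p` lead from `s` to `s'` within time
`t`. -/
inductive Iter (e : Expr) (p : Prog) : State → State → ℕ → Prop
  | refl (s : State) (t : ℕ) : Iter e p s s t
  | step {s s' s'' : State} {t t' t'' : ℕ} (he : e.eval s ≠ 0) (hp : ExecLE p s s' t)
      (hl : Iter e p s' s'' t') (ht : e.cost s + 1 + t + t' ≤ t'') : Iter e p s s'' t''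

/-- Partial runs of a loop can be concatenated. This permits induction over a clique-width
expression, where a subexpression corresponds to a stretch of iterations of one loop. -/
theorem Iter.trans {e : Expr} {p : Prog} {s s' s'' : State} {t t' : ℕ} (h : Iter e p s s' t)
    (h' : Iter e p s' s'' t') : Iter e p s s'' (t + t') := by
  induction h generalizing t' with
  | refl s t =>
    cases h' with
    | refl => exact .refl _ _
    | step he hp hl ht => exact .step he hp hl (by omega)
  | step he hp hl ht ih => exact .step he hp (ih h') (by omega)

theorem Iter.mono {e : Expr} {p : Prog} {s s' : State} {t t' : ℕ} (h : Iter e p s s' t)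
    (ht : t ≤ t') : Iter e p s s' t' := by
  have := h.trans (.refl (p := p) (e := e) s' (t' - t))
  rwa [Nat.add_sub_cancel' ht] at this

theorem Iter.execLE {e : Expr} {p : Prog} {s s' : State} {t : ℕ} (h : Iter e p s s' t)
    (he : e.eval s' = 0) : ExecLE (.loop e p) s s' (t + e.cost s' + 1) := by
  induction h with
  | refl s t => exact ⟨_, by omega, .loop_done he⟩
  | step he' hp hl ht ih =>
    obtain ⟨u, hu, h⟩ := ih he
    obtain ⟨v, hv, h'⟩ := hp
    exact ⟨_, by omega, .loop_step he' h' h⟩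

/-- Iterations through a given sequence of states. -/
theorem Iter.of_seq {e : Expr} {p : Prog} {m c : ℕ} (f : ℕ → State)
    (h : ∀ i < m, e.eval (f i) ≠ 0 ∧ ExecLE p (f i) (f (i + 1)) c ∧ e.cost (f i) + 1 ≤ c) :
    Iter e p (f 0) (f m) (m * (2 * c)) := by
  induction m with
  | zero => exact .refl _ _
  | succ m ih =>
    have h1 := ih fun i hi => h i (by omega)
    obtain ⟨h2, h3, h4⟩ := h m (by omega)
    have : Iter e p (f m) (f (m + 1)) (2 * c) := .step h2 h3 (.refl _ 0) (by omega)
    refine (h1.trans this).mono (Nat.succ_mul m (2 * c)).ge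

/-- A state whose registers are given by a list. -/
def st (R : List ℕ) (m : ℕ → ℕ) : State := ⟨fun r => R.getD r 0, m⟩

theorem update_getD (R : List ℕ) (i v : ℕ) (hi : i < R.length) :
    Function.update (fun r => R.getD r 0) i v = fun r => (R.set i v).getD r 0 := by
  funext r
  rcases eq_or_ne r i with rfl | h
  · simp [hi]
  · simp [Function.update_of_ne h, List.getElem?_set_ne h.symm, List.getD_eq_getElem?_getD]

theorem st_bounded {R : List ℕ} {m : ℕ → ℕ} {b : ℕ} (hR : ∀ x ∈ R, Nat.size x ≤ b)
    (hm : ∀ a, Nat.size (m a) ≤ b) : (st R m).Bounded b := by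
  refine ⟨fun r => ?_, hm⟩
  simp only [st, List.getD_eq_getElem?_getD]
  cases h : R[r]? with
  | none => simp
  | some x => exact hR x (List.mem_of_getElem? h)

/-- A memory that holds the list `l`, followed by two interleaved arrays. -/
def memOf (l : List ℕ) (d t : ℕ → ℕ) (a : ℕ) : ℕ :=
  if a < l.length then l.getD a 0 else
    if (a - l.length) % 2 = 0 then d ((a - l.length) / 2) else t ((a - l.length) / 2)

theorem memOf_left {l : List ℕ} (d t : ℕ → ℕ) {a : ℕ} (h : a < l.length) :
    memOf l d t a = l.getD a 0 := if_pos h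

/-- The arrays are interleaved because both are unbounded: labels are arbitrary numbers that serve
directly as indices, so no fixed address could separate the two. -/
theorem memOf_even (l : List ℕ) (d t : ℕ → ℕ) (x : ℕ) :
    memOf l d t (l.length + 2 * x) = d x := by
  simp [memOf]

theorem memOf_odd (l : List ℕ) (d t : ℕ → ℕ) (x : ℕ) :
    memOf l d t (l.length + (2 * x + 1)) = t x := by
  have h1 : (2 * x + 1) % 2 = 1 := by omega
  have h2 : (2 * x + 1) / 2 = x := by omega
  simp [memOf, h1, h2]

theorem update_memOf_even (l : List ℕ) (d t : ℕ → ℕ) (x v : ℕ) :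
    Function.update (memOf l d t) (l.length + 2 * x) v = memOf l (Function.update d x v) t := by
  funext a
  simp only [memOf, Function.update_apply]
  split_ifs <;> first | rfl | omega

theorem update_memOf_odd (l : List ℕ) (d t : ℕ → ℕ) (x v : ℕ) :
    Function.update (memOf l d t) (l.length + (2 * x + 1)) v =
      memOf l d (Function.update t x v) := by
  funext a
  simp only [memOf, Function.update_apply]
  split_ifs <;> first | rfl | omega

theorem size_memOf_le {l : List ℕ} {d t : ℕ → ℕ} {b : ℕ} (hl : ∀ x ∈ l, Nat.size x ≤ b)
    (hd : ∀ x, Nat.size (d x) ≤ b) (ht : ∀ x, Nat.size (t x) ≤ b) (a : ℕ) :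
    Nat.size (memOf l d t a) ≤ b := by
  unfold memOf
  split_ifs with h
  · rw [List.getD_eq_getElem _ _ h]; exact hl _ (List.getElem_mem h)
  · exact hd _
  · exact ht _

theorem start_eq_st (l : List ℕ) :
    start l = st (l.length :: List.replicate 11 0) (memOf l 0 0) := by
  unfold start st
  congr 1
  · funext r
    rcases r with _ | r
    · simp
    · rw [if_neg r.succ_ne_zero, List.getD_cons_succ, List.getD_eq_getElem?_getD,
        List.getElem?_replicate]
      split_ifs <;> rfl
  · funext a
    unfold memOf
    split_ifs with h
    · rfl
    · simp [List.getD_eq_getElem?_getD, List.getElem?_eq_none (not_lt.1 h)]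
    · simp [List.getD_eq_getElem?_getD, List.getElem?_eq_none (not_lt.1 h)]

end RAM

/-! ### Partial solutions of a clique-width expression -/

namespace SimpleGraph

variable {V : Type*}

/-- The vertex `v` has no neighbor in `S`. -/
def IsolatedIn (G : SimpleGraph V) (S : Finset V) (v : V) : Prop :=
  ∀ w ∈ S, ¬ G.Adj v w

/-- The maximum degree of `G[S]` is at most `1`. -/
def DegLeOneOn (G : SimpleGraph V) (S : Finset V) : Prop :=
  ∀ u ∈ S, ∀ v ∈ S, ∀ w ∈ S, G.Adj u v → G.Adj u w → v = w

open Classical in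
/-- The isolated vertices of `G[S]`. -/
noncomputable def isolated (G : SimpleGraph V) (S : Finset V) : Finset V :=
  S.filter (G.IsolatedIn S)

theorem mem_isolated {G : SimpleGraph V} {S : Finset V} {v : V} :
    v ∈ G.isolated S ↔ v ∈ S ∧ G.IsolatedIn S v := by
  simp [isolated]

theorem isolated_subset (G : SimpleGraph V) (S : Finset V) : G.isolated S ⊆ S :=
  fun _ h => (mem_isolated.1 h).1

end SimpleGraph

namespace LabeledGraph

variable {V : Type*}

/-- The set `S` contains vertices of both labels. -/
def HasBoth (H : LabeledGraph V) (i j : ℕ) (S : Finset V) : Prop :=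
  (∃ v ∈ S, H.lab v = i) ∧ ∃ v ∈ S, H.lab v = j

/-- For every label `i`, the set `S` contains no vertex of label `i` if `z i = 0`, only vertices
that are isolated in `G[S]` if `z i = 1`, and only vertices that are not if `z i = 2`. -/
def Compat (H : LabeledGraph V) (S : Finset V) (z : ℕ → ℕ) : Prop :=
  ∀ v ∈ S, z (H.lab v) = 1 ∧ H.graph.IsolatedIn S v ∨ z (H.lab v) = 2 ∧ ¬ H.graph.IsolatedIn S v

/-- State 0 selects the compatible sets that avoid a label, since the other states allow empty
classes. This is what makes inclusion–exclusion over empty classes possible. -/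
theorem compat_update_zero {H : LabeledGraph V} {S : Finset V} {z : ℕ → ℕ} {i : ℕ} :
    H.Compat S (Function.update z i 0) ↔ ¬ (∃ v ∈ S, H.lab v = i) ∧ H.Compat S z := by
  constructor
  · intro h
    have h0 : ∀ v ∈ S, H.lab v ≠ i := by
      intro v hv hvi
      have := h v hv
      simp [hvi] at this
    refine ⟨fun ⟨v, hv, hvi⟩ => h0 v hv hvi, fun v hv => ?_⟩
    have := h v hv
    rwa [Function.update_of_ne (h0 v hv)] at this
  · rintro ⟨h0, h⟩ v hv
    rw [Function.update_of_ne fun hvi => h0 ⟨v, hv, hvi⟩]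
    exact h v hv

theorem compat_update_of_not_exists {H : LabeledGraph V} {S : Finset V} {i : ℕ}
    (h0 : ¬ ∃ v ∈ S, H.lab v = i) (z : ℕ → ℕ) (c : ℕ) :
    H.Compat S (Function.update z i c) ↔ H.Compat S z := by
  refine forall₂_congr fun v hv => ?_
  rw [Function.update_of_ne fun hvi => h0 ⟨v, hv, hvi⟩]

end LabeledGraph

/-! ### Effect of the operations on degrees, isolated vertices and states -/

namespace CWExpr

variable {V : Type*} [DecidableEq V]

/-- Whenever a join adds edges between vertices in `S`, all vertices in `S` of the two labels are
isolated before the join. -/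
def Ok : CWExpr V → Finset V → Prop
  | single _ _, _ => True
  | union φ ψ, S => φ.Ok (S ∩ φ.eval.verts) ∧ ψ.Ok (S ∩ ψ.eval.verts)
  | join i j φ, S => φ.Ok S ∧ (φ.eval.HasBoth i j S →
      ∀ v ∈ S, φ.eval.lab v = i ∨ φ.eval.lab v = j → φ.eval.graph.IsolatedIn S v)
  | relabel _ _ φ, S => φ.Ok S

open Classical in
/-- The number of joins that add edges between vertices in `S`. -/
noncomputable def numJoins : CWExpr V → Finset V → ℕ
  | single _ _, _ => 0
  | union φ ψ, S => φ.numJoins (S ∩ φ.eval.verts) + ψ.numJoins (S ∩ ψ.eval.verts)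
  | join i j φ, S => φ.numJoins S + if φ.eval.HasBoth i j S then 1 else 0
  | relabel _ _ φ, S => φ.numJoins S

theorem adj_join {i j : ℕ} {φ : CWExpr V} {u v : V} :
    (join i j φ).eval.graph.Adj u v ↔ φ.eval.graph.Adj u v ∨ u ≠ v ∧
      ((u ∈ φ.eval.verts ∧ φ.eval.lab u = i) ∧ (v ∈ φ.eval.verts ∧ φ.eval.lab v = j) ∨
        (v ∈ φ.eval.verts ∧ φ.eval.lab v = i) ∧ (u ∈ φ.eval.verts ∧ φ.eval.lab u = j)) :=
  Iff.rfl

theorem adj_join_of_lab_ne {i j : ℕ} {φ : CWExpr V} {u v : V} (hi : φ.eval.lab u ≠ i)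
    (hj : φ.eval.lab u ≠ j) :
    (join i j φ).eval.graph.Adj u v ↔ φ.eval.graph.Adj u v := by
  rw [adj_join]; tauto

theorem adj_join_of_not_hasBoth {i j : ℕ} {φ : CWExpr V} {S : Finset V} {u v : V}
    (h : ¬ φ.eval.HasBoth i j S) (hu : u ∈ S) (hv : v ∈ S) :
    (join i j φ).eval.graph.Adj u v ↔ φ.eval.graph.Adj u v := by
  rw [adj_join]
  refine ⟨?_, Or.inl⟩
  rintro (h' | ⟨-, ⟨⟨-, h1⟩, -, h2⟩ | ⟨⟨-, h1⟩, -, h2⟩⟩)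
  · exact h'
  · exact (h ⟨⟨u, hu, h1⟩, v, hv, h2⟩).elim
  · exact (h ⟨⟨v, hv, h1⟩, u, hu, h2⟩).elim

theorem isolatedIn_join_of_not_hasBoth {i j : ℕ} {φ : CWExpr V} {S : Finset V} {u : V}
    (h : ¬ φ.eval.HasBoth i j S) (hu : u ∈ S) :
    (join i j φ).eval.graph.IsolatedIn S u ↔ φ.eval.graph.IsolatedIn S u :=
  forall₂_congr fun _ hv => not_congr (adj_join_of_not_hasBoth h hu hv)

theorem not_isolatedIn_join {i j : ℕ} (hij : i ≠ j) {φ : CWExpr V} {S : Finset V} {u : V}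
    (hS : S ⊆ φ.eval.verts) (h : φ.eval.HasBoth i j S) (hu : u ∈ S)
    (hl : φ.eval.lab u = i ∨ φ.eval.lab u = j) :
    ¬ (join i j φ).eval.graph.IsolatedIn S u := by
  obtain ⟨⟨v, hv, hvi⟩, w, hw, hwj⟩ := h
  intro hiso
  rcases hl with hl | hl
  · exact hiso w hw (adj_join.2 (.inr ⟨fun h => hij (by rw [← hl, h, hwj]),
      .inl ⟨⟨hS hu, hl⟩, hS hw, hwj⟩⟩))
  · exact hiso v hv (adj_join.2 (.inr ⟨fun h => hij (by rw [← hvi, ← h, hl]),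
      .inr ⟨⟨hS hv, hvi⟩, hS hu, hl⟩⟩))

theorem isolatedIn_join_of_lab_ne {i j : ℕ} {φ : CWExpr V} {S : Finset V} {u : V}
    (hi : φ.eval.lab u ≠ i) (hj : φ.eval.lab u ≠ j) :
    (join i j φ).eval.graph.IsolatedIn S u ↔ φ.eval.graph.IsolatedIn S u :=
  forall₂_congr fun _ _ => not_congr (adj_join_of_lab_ne hi hj)

section Union

variable {φ ψ : CWExpr V} (hd : Disjoint φ.eval.verts ψ.eval.verts) {S : Finset V} {u : V}
include hd

theorem adj_union_left {v : V} (hu : u ∈ φ.eval.verts) :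
    (union φ ψ).eval.graph.Adj u v ↔ φ.eval.graph.Adj u v :=
  ⟨fun h => h.resolve_right fun h' => Finset.disjoint_left.1 hd hu (ψ.eval.mem_verts h'), .inl⟩

theorem adj_union_right {v : V} (hu : u ∈ ψ.eval.verts) :
    (union φ ψ).eval.graph.Adj u v ↔ ψ.eval.graph.Adj u v :=
  ⟨fun h => h.resolve_left fun h' => Finset.disjoint_left.1 hd (φ.eval.mem_verts h') hu, .inr⟩

theorem isolatedIn_union_left (hu : u ∈ φ.eval.verts) :
    (union φ ψ).eval.graph.IsolatedIn S u ↔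
      φ.eval.graph.IsolatedIn (S ∩ φ.eval.verts) u := by
  refine ⟨fun h w hw hadj => h w (Finset.mem_inter.1 hw).1 (.inl hadj), fun h w hw hadj => ?_⟩
  rw [adj_union_left hd hu] at hadj
  exact h w (Finset.mem_inter.2 ⟨hw, φ.eval.mem_verts hadj.symm⟩) hadj

theorem isolatedIn_union_right (hu : u ∈ ψ.eval.verts) :
    (union φ ψ).eval.graph.IsolatedIn S u ↔
      ψ.eval.graph.IsolatedIn (S ∩ ψ.eval.verts) u := by
  refine ⟨fun h w hw hadj => h w (Finset.mem_inter.1 hw).1 (.inr hadj), fun h w hw hadj => ?_⟩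
  rw [adj_union_right hd hu] at hadj
  exact h w (Finset.mem_inter.2 ⟨hw, ψ.eval.mem_verts hadj.symm⟩) hadj

theorem card_eq_add (hS : S ⊆ φ.eval.verts ∪ ψ.eval.verts) :
    S.card = (S ∩ φ.eval.verts).card + (S ∩ ψ.eval.verts).card := by
  rw [← Finset.card_union_of_disjoint
    (hd.mono Finset.inter_subset_right Finset.inter_subset_right),
    ← Finset.inter_union_distrib_left, Finset.inter_eq_left.2 hS]

theorem card_isolated_union (hS : S ⊆ φ.eval.verts ∪ ψ.eval.verts) :
    ((union φ ψ).eval.graph.isolated S).card =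
      (φ.eval.graph.isolated (S ∩ φ.eval.verts)).card +
        (ψ.eval.graph.isolated (S ∩ ψ.eval.verts)).card := by
  rw [← Finset.card_union_of_disjoint]
  · congr 1
    ext v
    simp only [SimpleGraph.mem_isolated, Finset.mem_union, Finset.mem_inter]
    constructor
    · rintro ⟨hv, h⟩
      rcases Finset.mem_union.1 (hS hv) with h' | h'
      · exact .inl ⟨⟨hv, h'⟩, (isolatedIn_union_left hd h').1 h⟩
      · exact .inr ⟨⟨hv, h'⟩, (isolatedIn_union_right hd h').1 h⟩
    · rintro (⟨⟨hv, h'⟩, h⟩ | ⟨⟨hv, h'⟩, h⟩)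
      · exact ⟨hv, (isolatedIn_union_left hd h').2 h⟩
      · exact ⟨hv, (isolatedIn_union_right hd h').2 h⟩
  · refine Finset.disjoint_left.2 fun v h1 h2 => ?_
    rw [SimpleGraph.mem_isolated, Finset.mem_inter] at h1 h2
    exact Finset.disjoint_left.1 hd h1.1.2 h2.1.2

theorem degLeOneOn_union (hS : S ⊆ φ.eval.verts ∪ ψ.eval.verts) :
    (union φ ψ).eval.graph.DegLeOneOn S ↔
      φ.eval.graph.DegLeOneOn (S ∩ φ.eval.verts) ∧
        ψ.eval.graph.DegLeOneOn (S ∩ ψ.eval.verts) := by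
  constructor
  · refine fun h => ⟨fun u hu v hv w hw h1 h2 => ?_, fun u hu v hv w hw h1 h2 => ?_⟩ <;>
      rw [Finset.mem_inter] at hu hv hw
    · exact h u hu.1 v hv.1 w hw.1 (.inl h1) (.inl h2)
    · exact h u hu.1 v hv.1 w hw.1 (.inr h1) (.inr h2)
  · rintro ⟨h1, h2⟩ u hu v hv w hw huv huw
    rcases Finset.mem_union.1 (hS hu) with h' | h'
    · rw [adj_union_left hd h'] at huv huw
      exact h1 u (Finset.mem_inter.2 ⟨hu, h'⟩) v
        (Finset.mem_inter.2 ⟨hv, φ.eval.mem_verts huv.symm⟩) w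
        (Finset.mem_inter.2 ⟨hw, φ.eval.mem_verts huw.symm⟩) huv huw
    · rw [adj_union_right hd h'] at huv huw
      exact h2 u (Finset.mem_inter.2 ⟨hu, h'⟩) v
        (Finset.mem_inter.2 ⟨hv, ψ.eval.mem_verts huv.symm⟩) w
        (Finset.mem_inter.2 ⟨hw, ψ.eval.mem_verts huw.symm⟩) huv huw

/-- Compatibility is a condition on single vertices, and a vertex sees only its own side of the
union. Hence both sides use the same `z`. -/
theorem compat_union (hS : S ⊆ φ.eval.verts ∪ ψ.eval.verts) (z : ℕ → ℕ) :
    (union φ ψ).eval.Compat S z ↔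
      φ.eval.Compat (S ∩ φ.eval.verts) z ∧ ψ.eval.Compat (S ∩ ψ.eval.verts) z := by
  have hl : ∀ v ∈ φ.eval.verts, (union φ ψ).eval.lab v = φ.eval.lab v := fun v hv => if_pos hv
  have hr : ∀ v ∈ ψ.eval.verts, (union φ ψ).eval.lab v = ψ.eval.lab v :=
    fun v hv => if_neg fun h => Finset.disjoint_left.1 hd h hv
  constructor
  · refine fun h => ⟨fun v hv => ?_, fun v hv => ?_⟩ <;> rw [Finset.mem_inter] at hv
    · have := h v hv.1
      rwa [hl v hv.2, isolatedIn_union_left hd hv.2] at this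
    · have := h v hv.1
      rwa [hr v hv.2, isolatedIn_union_right hd hv.2] at this
  · rintro ⟨h1, h2⟩ v hv
    rcases Finset.mem_union.1 (hS hv) with h' | h'
    · rw [hl v h', isolatedIn_union_left hd h']
      exact h1 v (Finset.mem_inter.2 ⟨hv, h'⟩)
    · rw [hr v h', isolatedIn_union_right hd h']
      exact h2 v (Finset.mem_inter.2 ⟨hv, h'⟩)

end Union

open Classical in
/-- The vertices in `S` of label `i` or `j`. -/
noncomputable def joined (i j : ℕ) (φ : CWExpr V) (S : Finset V) : Finset V :=
  S.filter fun v => φ.eval.lab v = i ∨ φ.eval.lab v = j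

theorem mem_joined {i j : ℕ} {φ : CWExpr V} {S : Finset V} {v : V} :
    v ∈ φ.joined i j S ↔ v ∈ S ∧ (φ.eval.lab v = i ∨ φ.eval.lab v = j) := by
  simp [joined]

theorem two_le_card_joined {i j : ℕ} (hij : i ≠ j) {φ : CWExpr V} {S : Finset V}
    (h : φ.eval.HasBoth i j S) : 2 ≤ (φ.joined i j S).card := by
  obtain ⟨⟨v, hv, hvi⟩, w, hw, hwj⟩ := h
  exact Finset.one_lt_card.2 ⟨v, mem_joined.2 ⟨hv, .inl hvi⟩, w, mem_joined.2 ⟨hw, .inr hwj⟩,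
    fun h => hij (by rw [← hvi, h, hwj])⟩

theorem isolated_join_of_not_hasBoth {i j : ℕ} {φ : CWExpr V} {S : Finset V}
    (h : ¬ φ.eval.HasBoth i j S) :
    (join i j φ).eval.graph.isolated S = φ.eval.graph.isolated S := by
  ext v
  rw [SimpleGraph.mem_isolated, SimpleGraph.mem_isolated]
  exact and_congr_right fun hv => isolatedIn_join_of_not_hasBoth h hv

/-- Exactly the vertices of the two labels stop being isolated: each of them gets a neighbor, and
the edges at all other vertices stay the same. -/
theorem card_isolated_join {i j : ℕ} (hij : i ≠ j) {φ : CWExpr V} {S : Finset V}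
    (hS : S ⊆ φ.eval.verts) (h : φ.eval.HasBoth i j S)
    (hiso : ∀ v ∈ S, φ.eval.lab v = i ∨ φ.eval.lab v = j → φ.eval.graph.IsolatedIn S v) :
    ((join i j φ).eval.graph.isolated S).card + (φ.joined i j S).card =
      (φ.eval.graph.isolated S).card := by
  rw [← Finset.card_union_of_disjoint]
  · congr 1
    ext v
    simp only [Finset.mem_union, SimpleGraph.mem_isolated, mem_joined]
    constructor
    · rintro (⟨hv, h'⟩ | ⟨hv, h'⟩)
      · exact ⟨hv, fun w hw hadj => h' w hw (.inl hadj)⟩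
      · exact ⟨hv, hiso v hv h'⟩
    · rintro ⟨hv, h'⟩
      by_cases hl : φ.eval.lab v = i ∨ φ.eval.lab v = j
      · exact .inr ⟨hv, hl⟩
      · rw [not_or] at hl
        exact .inl ⟨hv, (isolatedIn_join_of_lab_ne hl.1 hl.2).2 h'⟩
  · refine Finset.disjoint_left.2 fun v h1 h2 => ?_
    rw [SimpleGraph.mem_isolated] at h1
    rw [mem_joined] at h2
    exact not_isolatedIn_join hij hS h h1.1 h2.2 h1.2

/-- A join that adds edges raises the second summand by 2 and uses up at least two isolated
vertices, at least one of each label. -/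
theorem Ok.card_le {φ : CWExpr V} (hφ : φ.WellFormed) {S : Finset V} (hS : S ⊆ φ.eval.verts)
    (h : φ.Ok S) : (φ.eval.graph.isolated S).card + 2 * φ.numJoins S ≤ S.card := by
  induction φ generalizing S with
  | single i v => simpa [numJoins] using Finset.card_le_card (SimpleGraph.isolated_subset _ S)
  | union φ ψ ih1 ih2 =>
    have h1 := ih1 hφ.1 Finset.inter_subset_right h.1
    have h2 := ih2 hφ.2.1 Finset.inter_subset_right h.2
    rw [card_isolated_union hφ.2.2 hS, card_eq_add hφ.2.2 hS, numJoins]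
    omega
  | join i j φ ih =>
    have h1 := ih hφ.1 hS h.1
    by_cases hb : φ.eval.HasBoth i j S
    · have h2 := card_isolated_join (φ := φ) hφ.2 hS hb (h.2 hb)
      have h3 := two_le_card_joined hφ.2 hb
      rw [numJoins, if_pos hb]
      omega
    · rwa [numJoins, if_neg hb, isolated_join_of_not_hasBoth hb]
  | relabel i j φ ih => exact ih hφ.1 hS h

/-- Equality in `Ok.card_le` means that every join adding edges meets exactly one vertex of each of
its labels, hence adds a single edge between two isolated vertices. -/
theorem degLeOneOn_iff {φ : CWExpr V} (hφ : φ.WellFormed) (hirr : φ.Irredundant) {S : Finset V}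
    (hS : S ⊆ φ.eval.verts) : φ.eval.graph.DegLeOneOn S ↔
      φ.Ok S ∧ (φ.eval.graph.isolated S).card + 2 * φ.numJoins S = S.card := by
  induction φ generalizing S with
  | single i v =>
    have h1 : (single i v).eval.graph.isolated S = S :=
      (SimpleGraph.isolated_subset _ S).antisymm
        fun v hv => SimpleGraph.mem_isolated.2 ⟨hv, fun w _ h => h.elim⟩
    simp only [Ok, numJoins, h1, true_and, mul_zero, add_zero, iff_true]
    exact fun u _ v _ w _ h => h.elim
  | union φ ψ ih1 ih2 =>
    rw [degLeOneOn_union hφ.2.2 hS, ih1 hφ.1 hirr.1 Finset.inter_subset_right,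
      ih2 hφ.2.1 hirr.2 Finset.inter_subset_right, card_isolated_union hφ.2.2 hS,
      card_eq_add hφ.2.2 hS, numJoins, Ok]
    constructor
    · rintro ⟨⟨h1, h2⟩, h3, h4⟩
      exact ⟨⟨h1, h3⟩, by omega⟩
    · rintro ⟨⟨h1, h2⟩, h3⟩
      -- The two inequalities add up to an equality, so each of them is one.
      have h4 := h1.card_le hφ.1 Finset.inter_subset_right
      have h5 := h2.card_le hφ.2.1 Finset.inter_subset_right
      exact ⟨⟨h1, by omega⟩, h2, by omega⟩
  | join i j φ ih =>
    by_cases hb : φ.eval.HasBoth i j S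
    · have h3 := two_le_card_joined hφ.2 hb
      constructor
      · intro h
        have hold : φ.eval.graph.DegLeOneOn S := fun u hu v hv w hw h1 h2 =>
          h u hu v hv w hw (.inl h1) (.inl h2)
        have hne : ∀ u v, φ.eval.lab u = i → φ.eval.lab v = j → u ≠ v :=
          fun u v hu hv huv => hφ.2 (by rw [← hu, huv, hv])
        have hadj : ∀ u ∈ S, ∀ v ∈ S, φ.eval.lab u = i → φ.eval.lab v = j →
            (join i j φ).eval.graph.Adj u v := fun u hu v hv hui hvj =>
          adj_join.2 (.inr ⟨hne u v hui hvj, .inl ⟨⟨hS hu, hui⟩, hS hv, hvj⟩⟩)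
        obtain ⟨⟨v, hv, hvi⟩, w, hw, hwj⟩ := id hb
        -- A new neighbor of `x` has the other label of the join. By the degree bound an old
        -- neighbor would coincide with it, and irredundancy forbids such an old edge.
        have hiso : ∀ x ∈ S, φ.eval.lab x = i ∨ φ.eval.lab x = j →
            φ.eval.graph.IsolatedIn S x := by
          rintro x hx (hxi | hxj) y hy hxy
          · have := h x hx y hy w hw (.inl hxy) (hadj x hx w hw hxi hwj)
            exact hirr.2 x y hxi (this ▸ hwj) hxy
          · have := h x hx y hy v hv (.inl hxy) (hadj v hv x hx hvi hxj).symm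
            exact hirr.2 y x (this ▸ hvi) hxj hxy.symm
        obtain ⟨h1, h2⟩ := (ih hφ.1 hirr.1 hS).1 hold
        have h4 : (φ.joined i j S).card ≤ 2 := by
          refine (Finset.card_le_card (t := {v, w}) fun x hx => ?_).trans Finset.card_le_two
          rw [Finset.mem_insert, Finset.mem_singleton]
          obtain ⟨hx, hxi | hxj⟩ := mem_joined.1 hx
          · exact .inl (h w hw x hx v hv (hadj x hx w hw hxi hwj).symm
              (hadj v hv w hw hvi hwj).symm)
          · exact .inr (h v hv x hx w hw (hadj v hv x hx hvi hxj) (hadj v hv w hw hvi hwj))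
        have h5 := card_isolated_join (φ := φ) hφ.2 hS hb hiso
        refine ⟨⟨h1, fun _ => hiso⟩, ?_⟩
        rw [numJoins, if_pos hb]
        omega
      · rintro ⟨⟨h1, h2⟩, h4⟩
        have h5 := h1.card_le hφ.1 hS
        have h6 := card_isolated_join (φ := φ) hφ.2 hS hb (h2 hb)
        rw [numJoins, if_pos hb] at h4
        -- Comparing `h4` with `h5` and `h6` leaves at most two joined vertices. There are at least
        -- two, so equality already holds before the join.
        have hold := (ih hφ.1 hirr.1 hS).2 ⟨h1, by omega⟩
        obtain ⟨⟨v, hv, hvi⟩, w, hw, hwj⟩ := id hb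
        have hvw : v ≠ w := fun h => hφ.2 (by rw [← hvi, h, hwj])
        have h7 : φ.joined i j S = {v, w} := by
          refine (Finset.eq_of_subset_of_card_le (fun x hx => ?_) ?_).symm
          · rw [Finset.mem_insert, Finset.mem_singleton] at hx
            rcases hx with rfl | rfl
            · exact mem_joined.2 ⟨hv, .inl hvi⟩
            · exact mem_joined.2 ⟨hw, .inr hwj⟩
          · rw [Finset.card_pair hvw]; omega
        have hi : ∀ x ∈ S, φ.eval.lab x = i → x = v := by
          intro x hx hxi
          have : x ∈ φ.joined i j S := mem_joined.2 ⟨hx, .inl hxi⟩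
          rw [h7, Finset.mem_insert, Finset.mem_singleton] at this
          exact this.resolve_right fun h => hφ.2 (by rw [← hxi, h, hwj])
        have hj : ∀ x ∈ S, φ.eval.lab x = j → x = w := by
          intro x hx hxj
          have : x ∈ φ.joined i j S := mem_joined.2 ⟨hx, .inr hxj⟩
          rw [h7, Finset.mem_insert, Finset.mem_singleton] at this
          exact this.resolve_left fun h => hφ.2 (by rw [← hxj, h, hvi])
        intro x hx y hy y' hy' h8 h9
        by_cases hxi : φ.eval.lab x = i
        · have hxiso := h2 hb x hx (.inl hxi)
          have key : ∀ y ∈ S, (join i j φ).eval.graph.Adj x y → y = w := by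
            intro y hy hxy
            rcases adj_join.1 hxy with h | ⟨-, h | h⟩
            · exact (hxiso y hy h).elim
            · exact hj y hy h.2.2
            · exact (hφ.2 (hxi.symm.trans h.2.2)).elim
          rw [key y hy h8, key y' hy' h9]
        · by_cases hxj : φ.eval.lab x = j
          · have hxiso := h2 hb x hx (.inr hxj)
            have key : ∀ y ∈ S, (join i j φ).eval.graph.Adj x y → y = v := by
              intro y hy hxy
              rcases adj_join.1 hxy with h | ⟨-, h | h⟩
              · exact (hxiso y hy h).elim
              · exact (hφ.2 (h.1.2.symm.trans hxj)).elim
              · exact hi y hy h.1.2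
            rw [key y hy h8, key y' hy' h9]
          · rw [adj_join_of_lab_ne hxi hxj] at h8 h9
            exact hold x hx y hy y' hy' h8 h9
    · rw [numJoins, if_neg hb, isolated_join_of_not_hasBoth hb]
      have h1 : (join i j φ).Ok S ↔ φ.Ok S := ⟨fun h => h.1, fun h => ⟨h, fun h' => (hb h').elim⟩⟩
      rw [h1, add_zero, ← ih hφ.1 hirr.1 hS]
      refine forall₂_congr fun u hu => forall₂_congr fun v hv => forall₂_congr fun w hw => ?_
      rw [adj_join_of_not_hasBoth hb hu hv, adj_join_of_not_hasBoth hb hu hw]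
  | relabel i j φ ih => exact ih hφ.1 hirr hS

end CWExpr

/-! ### The generating functions of the partial solutions -/

namespace CWExpr

variable {V : Type*} [DecidableEq V]

open Classical in
/-- The contribution of `S` to `CWExpr.table`. -/
noncomputable def weight (T Y : ℕ) (φ : CWExpr V) (z : ℕ → ℕ) (S : Finset V) : ℕ :=
  if φ.Ok S ∧ φ.eval.Compat S z then T ^ S.card * Y ^ φ.numJoins S else 0

/-- The partial solutions that are compatible with `z`, counted by their numbers of vertices and of
joins. -/
noncomputable def table (T Y : ℕ) (φ : CWExpr V) (z : ℕ → ℕ) : ℕ :=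
  ∑ S ∈ φ.eval.verts.powerset, φ.weight T Y z S

variable {T Y : ℕ}

theorem weight_congr {φ ψ : CWExpr V} {S : Finset V} {z z' : ℕ → ℕ}
    (h : φ.Ok S ∧ φ.eval.Compat S z ↔ ψ.Ok S ∧ ψ.eval.Compat S z')
    (hk : φ.numJoins S = ψ.numJoins S) : φ.weight T Y z S = ψ.weight T Y z' S := by
  unfold weight
  rw [hk]
  by_cases h' : ψ.Ok S ∧ ψ.eval.Compat S z'
  · rw [if_pos h', if_pos (h.2 h')]
  · rw [if_neg h', if_neg fun h'' => h' (h.1 h'')]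

theorem table_single (i : ℕ) (v : V) (z : ℕ → ℕ) :
    (single i v).table T Y z = 1 + if z i = 1 then T else 0 := by
  have h0 : (single i v).eval.Compat ∅ z := fun v hv => (Finset.notMem_empty v hv).elim
  have h1 : (single i v).eval.Compat {v} z ↔ z i = 1 := by
    have hiso : (single i v).eval.graph.IsolatedIn {v} v := fun w _ h => h.elim
    have hl : (single i v).eval.lab v = i := rfl
    constructor
    · intro h
      exact ((h v (Finset.mem_singleton_self v)).resolve_right fun h => h.2 hiso).1
    · intro h w hw
      rw [Finset.mem_singleton] at hw
      subst hw
      exact .inl ⟨by rw [hl, h], hiso⟩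
  have h2 : (single i v).eval.verts.powerset = {∅, {v}} := by
    ext S
    rw [Finset.mem_powerset, Finset.mem_insert, Finset.mem_singleton]
    exact Finset.subset_singleton_iff
  rw [table, h2, Finset.sum_pair (Finset.singleton_ne_empty v).symm]
  simp [weight, Ok, numJoins, h0, h1]

/-- Splitting `S` along the two vertex sets is a bijection under which sizes and numbers of joins
add up, so weights multiply. -/
theorem table_union {φ ψ : CWExpr V} (hd : Disjoint φ.eval.verts ψ.eval.verts) (z : ℕ → ℕ) :
    (union φ ψ).table T Y z = φ.table T Y z * ψ.table T Y z := by
  have h1 : ∀ S ∈ (union φ ψ).eval.verts.powerset, (union φ ψ).weight T Y z S =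
      φ.weight T Y z (S ∩ φ.eval.verts) * ψ.weight T Y z (S ∩ ψ.eval.verts) := by
    intro S hS
    have hS' : S ⊆ φ.eval.verts ∪ ψ.eval.verts := Finset.mem_powerset.1 hS
    have h := compat_union hd hS' z
    rw [weight, weight, weight]
    by_cases h1 : φ.Ok (S ∩ φ.eval.verts) ∧ φ.eval.Compat (S ∩ φ.eval.verts) z
    · by_cases h2 : ψ.Ok (S ∩ ψ.eval.verts) ∧ ψ.eval.Compat (S ∩ ψ.eval.verts) z
      · rw [if_pos h1, if_pos h2, if_pos ⟨⟨h1.1, h2.1⟩, h.2 ⟨h1.2, h2.2⟩⟩, card_eq_add hd hS',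
          numJoins]
        ring
      · rw [if_neg h2, mul_zero, if_neg fun h' => h2 ⟨h'.1.2, (h.1 h'.2).2⟩]
    · rw [if_neg h1, zero_mul, if_neg fun h' => h1 ⟨h'.1.1, (h.1 h'.2).1⟩]
  rw [table, Finset.sum_congr rfl h1, table, table, Finset.sum_mul_sum, ← Finset.sum_product']
  refine Finset.sum_nbij' (fun S => (S ∩ φ.eval.verts, S ∩ ψ.eval.verts)) (fun p => p.1 ∪ p.2)
    ?_ ?_ ?_ ?_ ?_
  · intro S _
    simp [Finset.inter_subset_right]
  · rintro ⟨A, B⟩ h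
    simp only [Finset.mem_product, Finset.mem_powerset] at h
    exact Finset.mem_powerset.2 (Finset.union_subset_union h.1 h.2)
  · intro S hS
    have hS' : S ⊆ φ.eval.verts ∪ ψ.eval.verts := Finset.mem_powerset.1 hS
    simp only [← Finset.inter_union_distrib_left, Finset.inter_eq_left.2 hS']
  · rintro ⟨A, B⟩ h
    simp only [Finset.mem_product, Finset.mem_powerset] at h
    have h2 : A ∩ ψ.eval.verts = ∅ := Finset.disjoint_iff_inter_eq_empty.1 (hd.mono_left h.1)
    have h3 : B ∩ φ.eval.verts = ∅ :=
      Finset.disjoint_iff_inter_eq_empty.1 (hd.symm.mono_left h.2)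
    simp [Finset.union_inter_distrib_right, h2, h3, Finset.inter_eq_left.2 h.1,
      Finset.inter_eq_left.2 h.2]
  · intro S _; rfl

/-- Vertices that had label `i` are now judged by the state of `j`, while the graph is unchanged. -/
theorem table_relabel (i j : ℕ) (φ : CWExpr V) (z : ℕ → ℕ) :
    (relabel i j φ).table T Y z = φ.table T Y (Function.update z i (z j)) := by
  refine Finset.sum_congr rfl fun S _ => weight_congr (and_congr Iff.rfl ?_) rfl
  refine forall₂_congr fun v _ => ?_
  have : z ((relabel i j φ).eval.lab v) = Function.update z i (z j) (φ.eval.lab v) := by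
    rw [Function.update_apply]
    exact apply_ite z _ _ _
  rw [this]
  rfl

/-- If the join adds edges inside `S`, both label classes pass from isolated to non-isolated, that
is from state 1 to state 2. All other labels keep their states. -/
theorem compat_join_iff {i j : ℕ} (hij : i ≠ j) {φ : CWExpr V} {S : Finset V}
    (hS : S ⊆ φ.eval.verts) (h : φ.eval.HasBoth i j S) (z : ℕ → ℕ) :
    (join i j φ).Ok S ∧ (join i j φ).eval.Compat S z ↔ (z i = 2 ∧ z j = 2) ∧ φ.Ok S ∧
      φ.eval.Compat S (Function.update (Function.update z i 1) j 1) := by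
  have hz : ∀ v, φ.eval.lab v = i ∨ φ.eval.lab v = j →
      Function.update (Function.update z i 1) j 1 (φ.eval.lab v) = 1 := by
    rintro v (hv | hv) <;> simp [hv, Function.update_apply]
  have hz' : ∀ v, ¬ (φ.eval.lab v = i ∨ φ.eval.lab v = j) →
      Function.update (Function.update z i 1) j 1 (φ.eval.lab v) = z (φ.eval.lab v) := by
    intro v hv
    rw [not_or] at hv
    simp [Function.update_of_ne, hv.1, hv.2]
  constructor
  · rintro ⟨⟨h1, h2⟩, h3⟩
    have h4 : ∀ v ∈ S, φ.eval.lab v = i ∨ φ.eval.lab v = j → z (φ.eval.lab v) = 2 :=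
      fun v hv hl => ((h3 v hv).resolve_left fun h' => not_isolatedIn_join hij hS h hv hl h'.2).1
    refine ⟨?_, h1, fun v hv => ?_⟩
    · obtain ⟨⟨v, hv, hvi⟩, w, hw, hwj⟩ := h
      exact ⟨hvi ▸ h4 v hv (.inl hvi), hwj ▸ h4 w hw (.inr hwj)⟩
    · by_cases hl : φ.eval.lab v = i ∨ φ.eval.lab v = j
      · exact .inl ⟨hz v hl, h2 h v hv hl⟩
      · rw [hz' v hl]
        rw [not_or] at hl
        rw [← isolatedIn_join_of_lab_ne hl.1 hl.2]
        exact h3 v hv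
  · rintro ⟨⟨h1, h2⟩, h3, h4⟩
    refine ⟨⟨h3, fun _ v hv hl => ?_⟩, fun v hv => ?_⟩
    · have := h4 v hv
      rw [hz v hl] at this
      exact (this.resolve_right fun h => by omega).2
    · by_cases hl : φ.eval.lab v = i ∨ φ.eval.lab v = j
      · refine .inr ⟨?_, not_isolatedIn_join hij hS h hv hl⟩
        rcases hl with hl | hl
        · exact (congrArg z hl).trans h1
        · exact (congrArg z hl).trans h2
      · have := h4 v hv
        rw [hz' v hl] at this
        rw [not_or] at hl
        rw [isolatedIn_join_of_lab_ne hl.1 hl.2]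
        exact this

theorem weight_update_zero {φ : CWExpr V} {S : Finset V} {i : ℕ} (h : ∃ v ∈ S, φ.eval.lab v = i)
    (z : ℕ → ℕ) : φ.weight T Y (Function.update z i 0) S = 0 :=
  if_neg fun h' => (LabeledGraph.compat_update_zero.1 h'.2).1 h

theorem weight_update_of_not_exists {φ : CWExpr V} {S : Finset V} {i : ℕ}
    (h : ¬ ∃ v ∈ S, φ.eval.lab v = i) (z : ℕ → ℕ) (c : ℕ) :
    φ.weight T Y (Function.update z i c) S = φ.weight T Y z S :=
  weight_congr (and_congr_right fun _ => LabeledGraph.compat_update_of_not_exists h z c) rfl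

/-- Either `S` misses one of the labels and the join does nothing to it, or it meets both and passes
from states 1, 1 to 2, 2. Here `D` is the contribution of `S` to the entry 1, 1 if `S` meets both
labels. The identities are additive so that they can be summed over `S` in `ℕ`. -/
theorem weight_join {i j : ℕ} (hij : i ≠ j) {φ : CWExpr V} {S : Finset V}
    (hS : S ⊆ φ.eval.verts) (z : ℕ → ℕ) :
    ∃ D, D + (φ.weight T Y (Function.update (Function.update z i 0) j 1) S +
        φ.weight T Y (Function.update (Function.update z i 1) j 0) S) =
      φ.weight T Y (Function.update (Function.update z i 1) j 1) S +
        φ.weight T Y (Function.update (Function.update z i 0) j 0) S ∧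
      (join i j φ).weight T Y z S + φ.weight T Y (Function.update (Function.update z i 0) j 0) S =
        φ.weight T Y (Function.update z j 0) S + φ.weight T Y (Function.update z i 0) S +
          (if z i = 2 ∧ z j = 2 then Y * D else 0) := by
  by_cases hb : φ.eval.HasBoth i j S
  · refine ⟨φ.weight T Y (Function.update (Function.update z i 1) j 1) S, ?_, ?_⟩
    · rw [Function.update_comm hij 0 1, weight_update_zero hb.1, weight_update_zero hb.2,
        weight_update_zero hb.2]
    · have h := compat_join_iff hij hS hb z
      rw [weight_update_zero hb.1, weight_update_zero hb.2, weight_update_zero hb.2, add_zero,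
        zero_add]
      by_cases hz : z i = 2 ∧ z j = 2
      · rw [if_pos hz, weight, weight, numJoins, if_pos hb]
        by_cases h' : φ.Ok S ∧ φ.eval.Compat S (Function.update (Function.update z i 1) j 1)
        · rw [if_pos h', if_pos (h.2 ⟨hz, h'⟩), pow_succ]
          ring
        · rw [if_neg h', if_neg fun h'' => h' (h.1 h'').2, mul_zero, add_zero]
      · rw [if_neg hz, weight, if_neg fun h'' => hz (h.1 h'').1]
  · refine ⟨0, ?_, ?_⟩
    · by_cases hi : ∃ v ∈ S, φ.eval.lab v = i
      · have hj : ¬ ∃ v ∈ S, φ.eval.lab v = j := fun hj => hb ⟨hi, hj⟩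
        simp only [weight_update_of_not_exists hj]
        omega
      · simp only [Function.update_comm hij, weight_update_of_not_exists hi]
        omega
    · have h : (join i j φ).weight T Y z S = φ.weight T Y z S := by
        refine weight_congr (and_congr ⟨fun h => h.1, fun h => ⟨h, fun h' => (hb h').elim⟩⟩ ?_)
          (by rw [numJoins, if_neg hb, add_zero])
        refine forall₂_congr fun v hv => ?_
        rw [isolatedIn_join_of_not_hasBoth hb hv]
        rfl
      rw [h, mul_zero, ite_self]
      by_cases hi : ∃ v ∈ S, φ.eval.lab v = i
      · have hj : ¬ ∃ v ∈ S, φ.eval.lab v = j := fun hj => hb ⟨hi, hj⟩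
        simp only [weight_update_of_not_exists hj]
        omega
      · simp only [Function.update_comm hij, weight_update_of_not_exists hi]
        omega

theorem table_join {i j : ℕ} (hij : i ≠ j) (φ : CWExpr V) (z : ℕ → ℕ) :
    (join i j φ).table T Y z =
      φ.table T Y (Function.update z j 0) + φ.table T Y (Function.update z i 0) -
        φ.table T Y (Function.update (Function.update z i 0) j 0) +
      if z i = 2 ∧ z j = 2 then
        Y * (φ.table T Y (Function.update (Function.update z i 1) j 1) +
          φ.table T Y (Function.update (Function.update z i 0) j 0) -
          (φ.table T Y (Function.update (Function.update z i 0) j 1) +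
            φ.table T Y (Function.update (Function.update z i 1) j 0))) else 0 := by
  have h := fun S (hS : S ∈ φ.eval.verts.powerset) =>
    weight_join (T := T) (Y := Y) hij (Finset.mem_powerset.1 hS) z
  choose! D h1 h2 using h
  have h3 := Finset.sum_congr rfl h1
  have h4 := Finset.sum_congr rfl h2
  simp only [Finset.sum_add_distrib] at h3 h4
  have h5 : ∑ S ∈ φ.eval.verts.powerset, (if z i = 2 ∧ z j = 2 then Y * D S else 0) =
      if z i = 2 ∧ z j = 2 then Y * ∑ S ∈ φ.eval.verts.powerset, D S else 0 := by
    split_ifs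
    · rw [Finset.mul_sum]
    · exact Finset.sum_const_zero
  rw [h5] at h4
  -- This makes the first truncated subtraction exact; `h3` does the same for the second.
  have h6 : φ.table T Y (Function.update (Function.update z i 0) j 0) ≤
      φ.table T Y (Function.update z j 0) := by
    refine Finset.sum_le_sum fun S _ => ?_
    by_cases hi : ∃ v ∈ S, φ.eval.lab v = i
    · rw [Function.update_comm hij, weight_update_zero hi]
      exact Nat.zero_le _
    · rw [Function.update_comm hij, weight_update_of_not_exists hi]
  change (join i j φ).table T Y z + _ = _ at h4
  change _ + (φ.table T Y _ + φ.table T Y _) = φ.table T Y _ + φ.table T Y _ at h3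
  change _ + φ.table T Y _ = φ.table T Y _ + φ.table T Y _ + _ at h4
  rw [← h3, Nat.add_sub_cancel]
  omega

theorem table_le {φ : CWExpr V} (hφ : φ.WellFormed) (hT : 1 ≤ T) (hY : 1 ≤ Y) (z : ℕ → ℕ) {n : ℕ}
    (hn : φ.eval.verts.card ≤ n) : φ.table T Y z ≤ 2 ^ n * (T ^ n * Y ^ n) := by
  have h : ∀ S ∈ φ.eval.verts.powerset, φ.weight T Y z S ≤ T ^ n * Y ^ n := by
    intro S hS
    rw [Finset.mem_powerset] at hS
    have hS' := Finset.card_le_card hS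
    unfold weight
    split_ifs with h
    · have := h.1.card_le hφ hS
      exact Nat.mul_le_mul (Nat.pow_le_pow_right hT (by omega)) (Nat.pow_le_pow_right hY (by omega))
    · exact Nat.zero_le _
  refine (Finset.sum_le_card_nsmul _ _ _ h).trans ?_
  rw [Finset.card_powerset, smul_eq_mul]
  exact Nat.mul_le_mul_right _ (Nat.pow_le_pow_right (by norm_num) hn)

end CWExpr

/-- Reading off a coefficient of a generating function, written in base `T`. -/
theorem sum_pow_div_mod {ι : Type*} (F : Finset ι) (e : ι → ℕ) {T : ℕ} (m : ℕ)
    (hT : F.card < T) :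
    (∑ i ∈ F, T ^ e i) / T ^ m % T = (F.filter fun i => e i = m).card := by
  have hT0 : 0 < T := by omega
  have h1 := Finset.sum_filter_add_sum_filter_not F (fun i => e i < m) fun i => T ^ e i
  have h2 := Finset.sum_filter_add_sum_filter_not (F.filter fun i => ¬ e i < m)
    (fun i => e i = m) fun i => T ^ e i
  have h3 : (F.filter fun i => ¬ e i < m).filter (fun i => e i = m) =
      F.filter fun i => e i = m := by
    rw [Finset.filter_filter]
    exact Finset.filter_congr fun i _ => by omega
  have h4 : ∑ i ∈ F.filter (fun i => e i = m), T ^ e i =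
      (F.filter fun i => e i = m).card * T ^ m := by
    rw [Finset.sum_congr rfl fun i hi => by rw [(Finset.mem_filter.1 hi).2], Finset.sum_const,
      smul_eq_mul]
  -- The terms above exponent `m` vanish modulo `T ^ (m + 1)`.
  obtain ⟨c, hc⟩ : T ^ (m + 1) ∣ ∑ i ∈ (F.filter fun i => ¬ e i < m).filter (fun i => ¬ e i = m),
      T ^ e i := by
    refine Finset.dvd_sum fun i hi => pow_dvd_pow _ ?_
    simp only [Finset.mem_filter] at hi
    omega
  -- Fewer than `T` terms, each at most `T ^ (m - 1)`, cause no carry into digit `m`.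
  have h5 : ∑ i ∈ F.filter (fun i => e i < m), T ^ e i < T ^ m := by
    rcases Nat.eq_zero_or_pos m with rfl | hm
    · simp
    · calc _ ≤ (F.filter fun i => e i < m).card • T ^ (m - 1) := by
            refine Finset.sum_le_card_nsmul _ _ _ fun i hi => Nat.pow_le_pow_right hT0 ?_
            have := (Finset.mem_filter.1 hi).2
            omega
        _ < T * T ^ (m - 1) := by
            rw [smul_eq_mul]
            exact Nat.mul_lt_mul_of_pos_right ((Finset.card_filter_le _ _).trans_lt hT)
              (by positivity)
        _ = T ^ m := by rw [← pow_succ', Nat.sub_add_cancel hm]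
  have h6 : ∑ i ∈ F, T ^ e i = ∑ i ∈ F.filter (fun i => e i < m), T ^ e i +
      T ^ m * ((F.filter fun i => e i = m).card + T * c) := by
    rw [← h1, ← h2, h3, h4, hc]
    ring
  rw [h6, Nat.add_mul_div_left _ _ (by positivity), Nat.div_eq_of_lt h5, zero_add,
    Nat.add_mul_mod_self_left]
  exact Nat.mod_eq_of_lt ((Finset.card_filter_le _ _).trans_lt hT)

/-! ### Induced matchings and 1-regular induced subgraphs -/

namespace SimpleGraph

variable {V : Type*} {G : SimpleGraph V}

/-- `G[S]` is `1`-regular. -/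
def OneRegularOn (G : SimpleGraph V) (S : Finset V) : Prop :=
  ∀ v ∈ S, ∃! w, w ∈ S ∧ G.Adj v w

/-- The set of the ends of the edges in `M`. -/
def endsFinset [DecidableEq V] (M : Finset (Sym2 V)) : Finset V := M.biUnion Sym2.toFinset

theorem mem_endsFinset [DecidableEq V] {M : Finset (Sym2 V)} {v : V} :
    v ∈ endsFinset M ↔ v ∈ edgeEnds M := by
  simp [endsFinset, edgeEnds]

theorem IsEdgeMatching.card_endsFinset [DecidableEq V] {M : Finset (Sym2 V)}
    (h : G.IsEdgeMatching M) :
    (endsFinset M).card = 2 * M.card := by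
  rw [endsFinset, Finset.card_biUnion]
  · rw [Finset.sum_congr rfl fun e he =>
      Sym2.card_toFinset_of_not_isDiag e (G.not_isDiag_of_mem_edgeSet (h.1 e he)),
      Finset.sum_const, smul_eq_mul, mul_comm]
  · intro e he f hf hef
    refine Finset.disjoint_left.2 fun v hve hvf => hef ?_
    rw [Sym2.mem_toFinset] at hve hvf
    exact h.2 v e he f hf hve hvf

/-- An induced matching is recovered from its set of ends: in the 1-regular graph on the ends, an
edge at `u` must be the matching edge at `u`. -/
theorem IsInducedMatching.mem_iff {M : Finset (Sym2 V)} (h : G.IsInducedMatching M)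
    (e : Sym2 V) : e ∈ M ↔ e ∈ G.edgeSet ∧ ∀ v ∈ e, v ∈ edgeEnds M := by
  refine ⟨fun he => ⟨h.1.1 e he, fun v hv => ⟨e, he, hv⟩⟩, ?_⟩
  rintro ⟨he, hv⟩
  induction e with
  | _ u w =>
    obtain ⟨f, hf, huf⟩ := hv u (Sym2.mem_mk_left u w)
    obtain ⟨x, rfl⟩ := Sym2.mem_iff_exists.1 huf
    obtain ⟨y, -, hy⟩ := h.2 u (hv u (Sym2.mem_mk_left u w))
    have h1 := hy w ⟨hv w (Sym2.mem_mk_right u w), he⟩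
    have h2 := hy x ⟨⟨_, hf, Sym2.mem_mk_right u x⟩, h.1.1 _ hf⟩
    rwa [h1, ← h2]

open Classical in
theorem numInducedMatchings_eq_card [Fintype V] (l : ℕ) :
    G.numInducedMatchings l =
      (Finset.univ.filter fun S : Finset V => G.OneRegularOn S ∧ S.card = 2 * l).card := by
  rw [← Set.ncard_coe_finset]
  refine Set.ncard_congr (fun M _ => endsFinset M) ?_ ?_ ?_
  · rintro M ⟨h, rfl⟩
    simp only [Finset.coe_filter, Finset.mem_univ, true_and, Set.mem_ofPred_eq]
    refine ⟨fun v hv => ?_, h.1.card_endsFinset⟩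
    simp only [mem_endsFinset] at hv ⊢
    exact h.2 v hv
  · rintro M M' ⟨h, -⟩ ⟨h', -⟩ heq
    have h1 : edgeEnds M = edgeEnds M' := by
      ext v
      simp only [← mem_endsFinset, heq]
    ext e
    rw [h.mem_iff, h'.mem_iff, h1]
  · intro S hS
    simp only [Finset.coe_filter, Finset.mem_univ, true_and, Set.mem_ofPred_eq] at hS
    obtain ⟨hS, hl⟩ := hS
    let M : Finset (Sym2 V) := Finset.univ.filter fun e => e ∈ G.edgeSet ∧ ∀ v ∈ e, v ∈ S
    have hM : ∀ e, e ∈ M ↔ e ∈ G.edgeSet ∧ ∀ v ∈ e, v ∈ S := fun e => by simp [M]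
    have hends : ∀ v, v ∈ edgeEnds M ↔ v ∈ S := by
      intro v
      constructor
      · rintro ⟨e, he, hv⟩
        exact ((hM e).1 he).2 v hv
      · intro hv
        obtain ⟨w, ⟨hw, hvw⟩, -⟩ := hS v hv
        refine ⟨s(v, w), (hM _).2 ⟨hvw, fun x hx => ?_⟩, Sym2.mem_mk_left v w⟩
        rcases Sym2.mem_iff.1 hx with rfl | rfl
        · exact hv
        · exact hw
    have hind : G.IsInducedMatching M := by
      refine ⟨⟨fun e he => ((hM e).1 he).1, fun v e he f hf hve hvf => ?_⟩, fun v hv => ?_⟩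
      · obtain ⟨x, rfl⟩ := Sym2.mem_iff_exists.1 hve
        obtain ⟨y, rfl⟩ := Sym2.mem_iff_exists.1 hvf
        rw [hM] at he hf
        rw [(hS v (he.2 v hve)).unique ⟨he.2 x (Sym2.mem_mk_right v x), he.1⟩
          ⟨hf.2 y (Sym2.mem_mk_right v y), hf.1⟩]
      · simp only [hends] at hv ⊢
        exact hS v hv
    have heq : endsFinset M = S := by
      ext v
      rw [mem_endsFinset, hends]
    refine ⟨M, ⟨hind, ?_⟩, heq⟩
    have := hind.1.card_endsFinset
    rw [heq, hl] at this
    omega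

theorem oneRegularOn_iff {S : Finset V} :
    G.OneRegularOn S ↔ G.DegLeOneOn S ∧ ∀ v ∈ S, ¬ G.IsolatedIn S v := by
  constructor
  · refine fun h => ⟨fun u hu v hv w hw h1 h2 => (h u hu).unique ⟨hv, h1⟩ ⟨hw, h2⟩,
      fun v hv h' => ?_⟩
    obtain ⟨w, ⟨hw, hvw⟩, -⟩ := h v hv
    exact h' w hw hvw
  · rintro ⟨h1, h2⟩ v hv
    have := h2 v hv
    simp only [IsolatedIn, not_forall, not_not] at this
    obtain ⟨w, hw, hvw⟩ := this
    exact ⟨w, ⟨hw, hvw⟩, fun x hx => h1 v hv x hx.1 w hw hx.2 hvw⟩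

end SimpleGraph

/-! ### Reading the numbers of induced matchings off the table -/

namespace CWExpr

variable {V : Type*} [DecidableEq V] [Fintype V]

/-- State 2 everywhere excludes isolated vertices, so `degLeOneOn_iff` leaves the condition that `S`
has twice as many vertices as joins. The exponent `(n + 3) * l` is `2 * l + (n + 1) * l`, the one
belonging to `2 * l` vertices and `l` joins. -/
theorem table_two_div_mod {φ : CWExpr V} {G : SimpleGraph V} (hφ : φ.Describes G)
    (hirr : φ.Irredundant) {n : ℕ} (hn : Fintype.card V = n) {T : ℕ} (hT : 2 ^ n < T) {l : ℕ}
    (hl : 2 * l ≤ n) :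
    φ.table T (T ^ (n + 1)) (fun _ => 2) / T ^ ((n + 3) * l) % T = G.numInducedMatchings l := by
  classical
  obtain ⟨hwf, huniv, rfl⟩ := hφ
  have hsub : ∀ S : Finset V, S ⊆ φ.eval.verts := fun S => huniv ▸ Finset.subset_univ S
  have h1 : φ.table T (T ^ (n + 1)) (fun _ => 2) =
      ∑ S ∈ Finset.univ.filter (fun S => φ.Ok S ∧ φ.eval.Compat S fun _ => 2),
        T ^ (S.card + (n + 1) * φ.numJoins S) := by
    rw [table, huniv, Finset.powerset_univ, Finset.sum_filter]
    refine Finset.sum_congr rfl fun S _ => if_congr Iff.rfl ?_ rfl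
    rw [pow_add T S.card, pow_mul]
  have h2 : (Finset.univ.filter fun S => φ.Ok S ∧ φ.eval.Compat S fun _ => 2).card < T := by
    refine lt_of_le_of_lt ((Finset.card_filter_le _ _).trans ?_) hT
    rw [Finset.card_univ, Fintype.card_finset, hn]
  rw [h1, sum_pow_div_mod _ _ _ h2, SimpleGraph.numInducedMatchings_eq_card, Finset.filter_filter]
  congr 1
  refine Finset.filter_congr fun S _ => ?_
  have hcompat : φ.eval.Compat S (fun _ => 2) ↔ ∀ v ∈ S, ¬ φ.eval.graph.IsolatedIn S v := by
    simp [LabeledGraph.Compat]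
  have hiso : (∀ v ∈ S, ¬ φ.eval.graph.IsolatedIn S v) → (φ.eval.graph.isolated S).card = 0 := by
    intro h
    rw [Finset.card_eq_zero, Finset.eq_empty_iff_forall_notMem]
    exact fun v hv => h v (SimpleGraph.mem_isolated.1 hv).1 (SimpleGraph.mem_isolated.1 hv).2
  have hSn : S.card ≤ n := hn ▸ Finset.card_le_univ S
  rw [SimpleGraph.oneRegularOn_iff, degLeOneOn_iff hwf hirr (hsub S), hcompat]
  constructor
  · rintro ⟨⟨h3, h4⟩, h5⟩
    -- As `S.card` and `2 * l` are both at most `n`, they and the numbers of joins are determined by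
    -- the exponent as its remainder and quotient modulo `n + 1`.
    have h6 : φ.numJoins S = l := by
      rcases lt_trichotomy (φ.numJoins S) l with h | h | h
      · have : (n + 1) * (φ.numJoins S + 1) ≤ (n + 1) * l := Nat.mul_le_mul_left _ h
        nlinarith
      · exact h
      · have : (n + 1) * (l + 1) ≤ (n + 1) * φ.numJoins S := Nat.mul_le_mul_left _ h
        nlinarith
    rw [h6] at h5
    have h7 : S.card = 2 * l := by nlinarith
    exact ⟨⟨⟨h3, by rw [hiso h4, h6, h7, zero_add]⟩, h4⟩, h7⟩
  · rintro ⟨⟨⟨h3, h4⟩, h5⟩, h6⟩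
    rw [hiso h5, h6, zero_add] at h4
    have h7 : φ.numJoins S = l := by omega
    exact ⟨⟨h3, h5⟩, by rw [h6, h7]; ring⟩

end CWExpr

/-! ### States of the labels as ternary numbers -/

theorem digit_add {q m c : ℕ} (h : q / 3 ^ m % 3 = 0) (hc : c < 3) (m' : ℕ) :
    (q + c * 3 ^ m) / 3 ^ m' % 3 = if m' = m then c else q / 3 ^ m' % 3 := by
  have h3 : ∀ k, 0 < 3 ^ k := fun k => by positivity
  split_ifs with hm
  · subst hm
    rw [Nat.add_mul_div_right _ _ (h3 _)]
    omega
  · rcases lt_or_gt_of_ne hm with hm | hm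
    · obtain ⟨k, rfl⟩ := Nat.exists_eq_add_of_lt hm
      have : q + c * 3 ^ (m' + k + 1) = q + 3 * (c * 3 ^ k) * 3 ^ m' := by ring
      rw [this, Nat.add_mul_div_right _ _ (h3 _)]
      omega
    · obtain ⟨k, rfl⟩ := Nat.exists_eq_add_of_lt hm
      rw [show 3 ^ (m + k + 1) = 3 ^ m * 3 * 3 ^ k by ring, ← Nat.div_div_eq_div_mul,
        ← Nat.div_div_eq_div_mul, ← Nat.div_div_eq_div_mul, ← Nat.div_div_eq_div_mul,
        Nat.add_mul_div_right _ _ (h3 _)]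
      congr 2
      omega

theorem digit_sub_self (q m : ℕ) : (q - q / 3 ^ m % 3 * 3 ^ m) / 3 ^ m % 3 = 0 := by
  rw [mul_comm, Nat.sub_mul_div]
  omega

theorem digit_mul_le (q w : ℕ) : q / w % 3 * w ≤ q :=
  (Nat.mul_le_mul_right _ (Nat.mod_le _ _)).trans (Nat.div_mul_le_self q w)

theorem digit_sub (q m m' : ℕ) :
    (q - q / 3 ^ m % 3 * 3 ^ m) / 3 ^ m' % 3 = if m' = m then 0 else q / 3 ^ m' % 3 := by
  have h := digit_add (digit_sub_self q m) (Nat.mod_lt (q / 3 ^ m) (by norm_num)) m'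
  rw [Nat.sub_add_cancel (digit_mul_le _ _)] at h
  split_ifs at h ⊢ with hm
  · rw [hm, digit_sub_self]
  · exact h.symm

theorem add_digit_lt {q m c k : ℕ} (h : q / 3 ^ m % 3 = 0) (hc : c < 3) (hm : m < k)
    (hq : q < 3 ^ k) : q + c * 3 ^ m < 3 ^ k := by
  obtain ⟨j, rfl⟩ := Nat.exists_eq_add_of_lt hm
  have h3 : 0 < 3 ^ m := by positivity
  have h1 : 3 ^ (m + j + 1) = 3 * 3 ^ j * 3 ^ m := by ring
  rw [h1] at hq ⊢
  have h2 := (Nat.div_lt_iff_lt_mul h3).2 hq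
  rw [← Nat.div_lt_iff_lt_mul h3, Nat.add_mul_div_right _ _ h3]
  omega

/-- `d` assigns to the labels in `A` the weights `3 ^ 0, …, 3 ^ (A.card - 1)`, and `0` to all other
numbers. -/
def IsDict (A : Finset ℕ) (d : ℕ → ℕ) : Prop :=
  ∃ f : ℕ → ℕ, Set.InjOn f A ∧ (∀ i ∈ A, f i < A.card ∧ d i = 3 ^ f i) ∧ ∀ i ∉ A, d i = 0

theorem isDict_empty : IsDict ∅ 0 := ⟨id, by simp, by simp, by simp⟩

theorem IsDict.eq_zero_iff {A : Finset ℕ} {d : ℕ → ℕ} (h : IsDict A d) {i : ℕ} :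
    d i = 0 ↔ i ∉ A := by
  obtain ⟨f, -, h2, h3⟩ := h
  refine ⟨fun h hi => ?_, h3 i⟩
  rw [(h2 i hi).2] at h
  exact absurd h (by positivity)

theorem IsDict.le {A : Finset ℕ} {d : ℕ → ℕ} (h : IsDict A d) (i : ℕ) : d i ≤ 3 ^ A.card := by
  by_cases hi : i ∈ A
  · obtain ⟨f, -, h2, -⟩ := h
    rw [(h2 i hi).2]
    exact Nat.pow_le_pow_right (by norm_num) (h2 i hi).1.le
  · rw [h.eq_zero_iff.2 hi]
    exact Nat.zero_le _

theorem IsDict.insert {A : Finset ℕ} {d : ℕ → ℕ} (h : IsDict A d) {i : ℕ} (hi : i ∉ A) :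
    IsDict (insert i A) (Function.update d i (3 ^ A.card)) := by
  obtain ⟨f, h1, h2, h3⟩ := h
  have hne : ∀ j ∈ A, j ≠ i := fun j hj h => hi (h ▸ hj)
  refine ⟨Function.update f i A.card, ?_, ?_, ?_⟩
  · intro j hj k hk hjk
    rw [Finset.coe_insert, Set.mem_insert_iff] at hj hk
    rcases hj with rfl | hj <;> rcases hk with rfl | hk
    · rfl
    · rw [Function.update_self, Function.update_of_ne (hne k hk)] at hjk
      exact absurd (h2 k hk).1 (by omega)
    · rw [Function.update_self, Function.update_of_ne (hne j hj)] at hjk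
      exact absurd (h2 j hj).1 (by omega)
    · rw [Function.update_of_ne (hne j hj), Function.update_of_ne (hne k hk)] at hjk
      exact h1 hj hk hjk
  · intro j hj
    rw [Finset.card_insert_of_notMem hi]
    rcases Finset.mem_insert.1 hj with rfl | hj
    · simp
    · rw [Function.update_of_ne (hne j hj), Function.update_of_ne (hne j hj)]
      exact ⟨(h2 j hj).1.trans (Nat.lt_succ_self _), (h2 j hj).2⟩
  · intro j hj
    rw [Finset.mem_insert, not_or] at hj
    rw [Function.update_of_ne hj.1, h3 j hj.2]

/-- The states of the labels that are encoded by `q`. -/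
def labelStates (d : ℕ → ℕ) (q : ℕ) : ℕ → ℕ := fun i => q / d i % 3

theorem IsDict.labelStates_sub {A : Finset ℕ} {d : ℕ → ℕ} (h : IsDict A d) {i : ℕ} (hi : i ∈ A)
    (q : ℕ) :
    labelStates d (q - q / d i % 3 * d i) = Function.update (labelStates d q) i 0 := by
  obtain ⟨f, h1, h2, h3⟩ := h
  funext j
  rw [Function.update_apply]
  by_cases hj : j ∈ A
  · simp only [labelStates]
    rw [(h2 i hi).2, (h2 j hj).2, digit_sub]
    exact if_congr (h1.eq_iff hj hi) rfl rfl
  -- A label outside `A` has weight 0, and division by 0 gives it the state 0.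
  · simp [labelStates, h3 j hj]

theorem IsDict.labelStates_add {A : Finset ℕ} {d : ℕ → ℕ} (h : IsDict A d) {i : ℕ} (hi : i ∈ A)
    {q c : ℕ} (hq : labelStates d q i = 0) (hc : c < 3) :
    labelStates d (q + c * d i) = Function.update (labelStates d q) i c := by
  obtain ⟨f, h1, h2, h3⟩ := h
  funext j
  rw [Function.update_apply]
  by_cases hj : j ∈ A
  · simp only [labelStates] at hq ⊢
    rw [(h2 i hi).2] at hq ⊢
    rw [(h2 j hj).2, digit_add hq hc]
    exact if_congr (h1.eq_iff hj hi) rfl rfl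
  · rw [if_neg fun hji : j = i => hj (hji ▸ hi)]
    simp [labelStates, h3 j hj]

theorem IsDict.add_lt {A : Finset ℕ} {d : ℕ → ℕ} (h : IsDict A d) {i : ℕ} (hi : i ∈ A)
    {q c : ℕ} (hq : labelStates d q i = 0) (hc : c < 3) (hA : q < 3 ^ A.card) :
    q + c * d i < 3 ^ A.card := by
  obtain ⟨f, h1, h2, h3⟩ := h
  simp only [labelStates] at hq
  rw [(h2 i hi).2] at hq ⊢
  exact add_digit_lt hq hc (h2 i hi).1 hA

theorem labelStates_sub_one {A : Finset ℕ} {d : ℕ → ℕ} (h : IsDict A d) {i : ℕ} (hi : i ∈ A) :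
    labelStates d (3 ^ A.card - 1) i = 2 := by
  obtain ⟨f, h1, h2, h3⟩ := h
  simp only [labelStates]
  rw [(h2 i hi).2]
  obtain ⟨k, hk⟩ := Nat.exists_eq_add_of_lt (h2 i hi).1
  rw [hk]
  -- The number whose digits are all 2 is cut below digit `f i`.
  have h4 : 3 ^ (f i + k + 1) - 1 = (3 ^ f i - 1) + (3 * 3 ^ k - 1) * 3 ^ f i := by
    rw [Nat.sub_mul]
    have h5 : 1 ≤ 3 ^ f i := Nat.one_le_pow _ _ (by norm_num)
    have h6 : 1 * 3 ^ f i ≤ 3 * 3 ^ k * 3 ^ f i :=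
      Nat.mul_le_mul_right _ (by have : 0 < 3 ^ k := by positivity
                                 omega)
    rw [show 3 ^ (f i + k + 1) = 3 * 3 ^ k * 3 ^ f i by ring]
    omega
  rw [h4, Nat.add_mul_div_right _ _ (by positivity), Nat.div_eq_of_lt (Nat.sub_lt (by positivity)
    (by norm_num))]
  have : 0 < 3 ^ k := by positivity
  omega

/-! ### Dependence on the occurring labels, and sizes of expressions -/

namespace CWExpr

theorem compat_congr {V : Type*} {H : LabeledGraph V} {S : Finset V} {z z' : ℕ → ℕ}
    (h : ∀ v ∈ S, z (H.lab v) = z' (H.lab v)) : H.Compat S z ↔ H.Compat S z' :=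
  forall₂_congr fun v hv => by rw [h v hv]

theorem lab_mem_labels {V : Type*} [DecidableEq V] {φ : CWExpr V} {v : V}
    (hv : v ∈ φ.eval.verts) : φ.eval.lab v ∈ φ.labels := by
  induction φ with
  | single i w => exact Finset.mem_singleton_self i
  | union φ ψ ih1 ih2 =>
    have hl : (union φ ψ).eval.lab v = if v ∈ φ.eval.verts then φ.eval.lab v else ψ.eval.lab v :=
      rfl
    rw [hl, labels, Finset.mem_union]
    split_ifs with h
    · exact .inl (ih1 h)
    · exact .inr (ih2 ((Finset.mem_union.1 hv).resolve_left h))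
  | join i j φ ih => exact Finset.mem_union_right _ (ih hv)
  | relabel i j φ ih =>
    have hl : (relabel i j φ).eval.lab v = if φ.eval.lab v = i then j else φ.eval.lab v := rfl
    rw [hl, labels, Finset.mem_union]
    split_ifs with h
    · exact .inl (by simp)
    · exact .inr (ih hv)

/-- Only occurring labels matter, so a ternary number, which describes only these, determines the
entry. -/
theorem table_congr {V : Type*} [DecidableEq V] {T Y : ℕ} {φ : CWExpr V} {z z' : ℕ → ℕ}
    (h : ∀ i ∈ φ.labels, z i = z' i) : φ.table T Y z = φ.table T Y z' :=
  Finset.sum_congr rfl fun _ hS => weight_congr (and_congr_right fun _ => compat_congr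
    fun _ hv => h _ (lab_mem_labels (Finset.mem_powerset.1 hS hv))) rfl

/-- The number of operations of an expression. -/
def numOps {V : Type*} : CWExpr V → ℕ
  | single _ _ => 1
  | union φ ψ => φ.numOps + ψ.numOps + 1
  | join _ _ φ => φ.numOps + 1
  | relabel _ _ φ => φ.numOps + 1

theorem length_encode {n : ℕ} (φ : CWExpr (Fin n)) : φ.encode.length = 3 * φ.numOps := by
  induction φ with
  | single i v => rfl
  | union φ ψ ih1 ih2 =>
    simp only [encode, List.length_append, List.length_cons, List.length_nil, numOps, ih1, ih2]
    ring
  | join i j φ ih | relabel i j φ ih =>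
    simp only [encode, List.length_append, List.length_cons, List.length_nil, numOps, ih]
    ring

theorem card_labels_le {V : Type*} (φ : CWExpr V) : φ.labels.card ≤ 2 * φ.numOps := by
  induction φ with
  | single i v => simp [labels, numOps]
  | union φ ψ ih1 ih2 =>
    have := Finset.card_union_le φ.labels ψ.labels
    simp only [labels, numOps]
    omega
  | join i j φ ih | relabel i j φ ih =>
    have := Finset.card_union_le {i, j} φ.labels
    have := Finset.card_le_two (a := i) (b := j)
    simp only [labels, numOps]
    omega

end CWExpr

/-! ### The program -/

namespace RAM

instance : Add Expr := ⟨.op .add⟩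
instance : Sub Expr := ⟨.op .sub⟩
instance : Mul Expr := ⟨.op .mul⟩
instance : Div Expr := ⟨.op .div⟩
instance : Mod Expr := ⟨.op .mod⟩

section Eval

variable (s : State) (a b : Expr) (R : List ℕ) (m : ℕ → ℕ) (r : ℕ)

theorem eval_add : (a + b).eval s = a.eval s + b.eval s := rfl
theorem eval_sub : (a - b).eval s = a.eval s - b.eval s := rfl
theorem eval_mul : (a * b).eval s = a.eval s * b.eval s := rfl
theorem eval_div : (a / b).eval s = a.eval s / b.eval s := rfl
theorem eval_mod : (a % b).eval s = a.eval s % b.eval s := rfl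
theorem eval_const (k : ℕ) : (Expr.const k).eval s = k := rfl
theorem eval_reg : (Expr.reg r).eval (st R m) = R.getD r 0 := rfl
theorem eval_load : (Expr.load a).eval (st R m) = m (a.eval (st R m)) := rfl
theorem run_skip : Prog.run .skip s = s := rfl
theorem run_ite (p q : Prog) :
    (Prog.ite a p q).run s = if a.eval s = 0 then q.run s else p.run s := ite_not ..
theorem run_store :
    (Prog.store a b).run (st R m) = st R (Function.update m (a.eval (st R m)) (b.eval (st R m))) :=
  rfl
variable {r R} in
theorem run_assign (h : r < R.length) :
    (Prog.assign r a).run (st R m) = st (R.set r (a.eval (st R m))) m := by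
  simp only [Prog.run, st, update_getD _ _ _ h]

end Eval

/-- A sequence of programs. -/
def Prog.block : List Prog → Prog
  | [] => .skip
  | p :: l => .seq p (block l)

theorem run_block_nil (s : State) : (Prog.block []).run s = s := rfl
theorem run_block_cons (p : Prog) (l : List Prog) (s : State) :
    (Prog.block (p :: l)).run s = (Prog.block l).run (p.run s) := rfl

/-- The address of the weight of a label. -/
def dictAddr (e : Expr) : Expr := .reg 0 + .const 2 * e

/-- The address of an entry of the current table. -/
def entryAddr (e : Expr) : Expr := .reg 0 + (.const 2 * (.reg 6 + e) + .const 1)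

/-- Registers: 0 the input length, 1 `n`, 2 `T`, 3 `Y`, 4 the table size `W`, 5 the reading
position, 6 the base of the top table, 7 the operation or a counter, 8 and 9 the weights of the two
labels (8 is later the output address), 10 the entry index, 11 the answer still to be decoded. -/
def initProg : Prog := .block
  [.assign 1 (.load (.const 0)), .assign 2 (.const 2), .assign 3 (.const 2), .assign 4 (.const 1),
    .assign 7 (.reg 1)]

/-- From `2 ^ k` and `2 ^ k ^ 2` to the next pair, by `(k + 1) ^ 2 = k ^ 2 + k + k + 1`; register 3
is therefore updated before register 2. -/
def powBody : Prog := .block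
  [.assign 3 (.reg 3 * .reg 2 * .reg 2 * .const 2), .assign 2 (.reg 2 * .const 2),
    .assign 7 (.reg 7 - .const 1)]

/-- The expression starts behind `n` and the `n * n` matrix entries. -/
def rewindProg : Prog := .assign 5 (.reg 1 * .reg 1 + .const 1)

/-- Give the label `e` a weight, unless it has one. -/
def register (e : Expr) : Prog :=
  .ite (.load (dictAddr e)) .skip
    (.block [.store (dictAddr e) (.reg 4), .assign 4 (.const 3 * .reg 4)])

/-- The first test is the distance of the operation code from 1: a union has no labels. In `single`
the third number is a vertex, so only codes above 1 register it. -/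
def dictBody : Prog := .block
  [.ite (.load (.reg 5) - .const 1 + (.const 1 - .load (.reg 5)))
      (register (.load (.reg 5 + .const 1))) .skip,
    .ite (.load (.reg 5) - .const 1) (register (.load (.reg 5 + .const 2))) .skip,
    .assign 5 (.reg 5 + .const 3)]

def moreTokens : Expr := .reg 0 - .reg 5

/-- A single vertex pushes a table and a union pops one. After the pop the operands lie at the base
and `W` above it. -/
def tokenPre : Prog := .block
  [.assign 7 (.load (.reg 5)), .assign 8 (.load (dictAddr (.load (.reg 5 + .const 1)))),
    .assign 9 (.load (dictAddr (.load (.reg 5 + .const 2)))), .assign 10 (.reg 4),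
    .ite (.reg 7) (.ite (.reg 7 - .const 1) .skip (.assign 6 (.reg 6 - .reg 4)))
      (.assign 6 (.reg 6 + .reg 4))]

/-- The digit of the table index for the weight in the register `r`. -/
def digit (r : ℕ) : Expr := .reg 10 / .reg r % .const 3

def entry (e : Expr) : Expr := .load (entryAddr e)

/-- For a state `s` below 3, `s * (2 - s)` is 1 if `s = 1` and 0 otherwise. -/
def singleExpr : Expr := .const 1 + .reg 2 * (digit 8 * (.const 2 - digit 8))

def unionExpr : Expr := entry (.reg 10) * entry (.reg 4 + .reg 10)

/-- For a state `s` below 3, `s / 2` is the indicator of `s = 2`. Subtracting `digit * weight` sets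
a state to 0. -/
def joinExpr : Expr :=
  entry (.reg 10 - digit 9 * .reg 9) + entry (.reg 10 - digit 8 * .reg 8) -
    entry (.reg 10 - digit 8 * .reg 8 - digit 9 * .reg 9) +
  digit 8 / .const 2 * (digit 9 / .const 2) * (.reg 3 *
    (entry (.reg 10 - digit 8 * .reg 8 - digit 9 * .reg 9 + .reg 8 + .reg 9) +
      entry (.reg 10 - digit 8 * .reg 8 - digit 9 * .reg 9) -
      (entry (.reg 10 - digit 8 * .reg 8 - digit 9 * .reg 9 + .reg 9) +
        entry (.reg 10 - digit 8 * .reg 8 - digit 9 * .reg 9 + .reg 8))))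

def relabelExpr : Expr := entry (.reg 10 - digit 8 * .reg 8 + digit 9 * .reg 8)

/-- The table is overwritten in place from the largest index down to 0, so entries with index at
most the current one are still old. -/
def entryBody : Prog := .block
  [.assign 10 (.reg 10 - .const 1),
    .ite (.reg 7)
      (.ite (.reg 7 - .const 1)
        (.ite (.reg 7 - .const 2) (.store (entryAddr (.reg 10)) relabelExpr)
          (.store (entryAddr (.reg 10)) joinExpr))
        (.store (entryAddr (.reg 10)) unionExpr))
      (.store (entryAddr (.reg 10)) singleExpr)]

def tokenPost : Prog := .block
  [.assign 5 (.reg 5 + .const 3), .assign 7 (.const 0), .assign 8 (.const 0), .assign 9 (.const 0)]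

def tokenBody : Prog := .block [tokenPre, .loop (.reg 10) entryBody, tokenPost]

def outputPre : Prog := .block
  [.assign 11 (entry (.reg 4 - .const 1)), .assign 7 (.reg 1 + .const 1)]

/-- With `Y = T ^ (n + 1)` the divisor is `T ^ (n + 3)`, the spacing of the wanted digits. -/
def outputBody : Prog := .block
  [.store (.reg 8) (.reg 11 % .reg 2), .assign 11 (.reg 11 / (.reg 3 * .reg 2 * .reg 2)),
    .assign 8 (.reg 8 + .const 1), .assign 7 (.reg 7 - .const 1)]

/-- Count the induced matchings of a graph that is given with a clique-width expression. -/
def countProg : Prog := .block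
  [initProg, .loop (.reg 7) powBody, rewindProg, .loop moreTokens dictBody, rewindProg,
    .loop moreTokens tokenBody, outputPre, .loop (.reg 7) outputBody]

/-- The new value of the entry `q` of the table at `cur`, after a token `op` with labels of weights
`a` and `b`. -/
def newEntry (T Y W cur op a b : ℕ) (t : ℕ → ℕ) (q : ℕ) : ℕ :=
  if op = 0 then 1 + T * (q / a % 3 * (2 - q / a % 3))
  else if op - 1 = 0 then t (cur + q) * t (cur + (W + q))
  else if op - 2 = 0 then
    t (cur + (q - q / b % 3 * b)) + t (cur + (q - q / a % 3 * a)) -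
      t (cur + (q - q / a % 3 * a - q / b % 3 * b)) +
    q / a % 3 / 2 * (q / b % 3 / 2) * (Y *
      (t (cur + (q - q / a % 3 * a - q / b % 3 * b + a + b)) +
        t (cur + (q - q / a % 3 * a - q / b % 3 * b)) -
        (t (cur + (q - q / a % 3 * a - q / b % 3 * b + b)) +
          t (cur + (q - q / a % 3 * a - q / b % 3 * b + a)))))
  else t (cur + (q - q / a % 3 * a + q / b % 3 * a))

/-! ### Effect of the loop-free parts of the program -/

section Run

variable (l : List ℕ) (n T Y W pos cur op a b q v : ℕ) (d t m : ℕ → ℕ)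

theorem run_initProg :
    initProg.run (st (l.length :: List.replicate 11 0) m) =
      st [l.length, m 0, 2, 2, 1, 0, 0, m 0, 0, 0, 0, 0] m := by
  simp [initProg, run_block_nil, run_block_cons, run_assign, eval_reg, eval_load, eval_const]

theorem run_powBody :
    powBody.run (st [l.length, n, T, Y, W, pos, cur, op, a, b, q, v] m) =
      st [l.length, n, T * 2, Y * T * T * 2, W, pos, cur, op - 1, a, b, q, v] m := by
  simp [powBody, run_block_nil, run_block_cons, run_assign, eval_reg, eval_const, eval_mul,
    eval_sub]

theorem run_rewindProg :
    rewindProg.run (st [l.length, n, T, Y, W, pos, cur, op, a, b, q, v] m) =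
      st [l.length, n, T, Y, W, n * n + 1, cur, op, a, b, q, v] m := by
  simp [rewindProg, run_assign, eval_reg, eval_const, eval_mul, eval_add]

theorem run_register (e : Expr) (i : ℕ)
    (he : e.eval (st [l.length, n, T, Y, W, pos, cur, op, a, b, q, v] (memOf l d t)) = i) :
    (register e).run (st [l.length, n, T, Y, W, pos, cur, op, a, b, q, v] (memOf l d t)) =
      if d i = 0 then
        st [l.length, n, T, Y, 3 * W, pos, cur, op, a, b, q, v] (memOf l (Function.update d i W) t)
      else st [l.length, n, T, Y, W, pos, cur, op, a, b, q, v] (memOf l d t) := by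
  simp [register, dictAddr, run_ite, run_skip, run_block_nil, run_block_cons, run_assign,
    run_store, eval_reg, eval_load, eval_const, eval_mul, eval_add, he, memOf_even,
    update_memOf_even]

theorem run_entryBody :
    entryBody.run (st [l.length, n, T, Y, W, pos, cur, op, a, b, q + 1, v] (memOf l d t)) =
      st [l.length, n, T, Y, W, pos, cur, op, a, b, q, v]
        (memOf l d (Function.update t (cur + q) (newEntry T Y W cur op a b t q))) := by
  unfold newEntry
  simp only [entryBody, run_block_nil, run_block_cons, run_ite, run_store, singleExpr, unionExpr,
    joinExpr, relabelExpr, entry, entryAddr, digit, eval_reg, eval_load, eval_const, eval_mul,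
    eval_add, eval_sub, eval_div, eval_mod, memOf_odd, update_memOf_odd,
    run_assign (r := 10) (R := [l.length, n, T, Y, W, pos, cur, op, a, b, q + 1, v])
      (h := Nat.lt_of_sub_eq_succ rfl), List.set_cons_succ, List.set_cons_zero, List.getD_cons_succ,
    List.getD_cons_zero, Nat.add_sub_cancel]
  split_ifs <;> rfl

theorem run_tokenPre {x y z : ℕ} (hpos : pos + 2 < l.length) (hx : l.getD pos 0 = x)
    (hy : l.getD (pos + 1) 0 = y) (hz : l.getD (pos + 2) 0 = z) :
    tokenPre.run (st [l.length, n, T, Y, W, pos, cur, 0, 0, 0, 0, 0] (memOf l d t)) =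
      st [l.length, n, T, Y, W, pos,
        if x = 0 then cur + W else if x - 1 = 0 then cur - W else cur, x, d y, d z, W, 0]
        (memOf l d t) := by
  have h0 := memOf_left d t (l := l) (a := pos) (by omega)
  have h1 := memOf_left d t (l := l) (a := pos + 1) (by omega)
  have h2 := memOf_left d t (l := l) (a := pos + 2) (by omega)
  rw [hx] at h0
  rw [hy] at h1
  rw [hz] at h2
  simp [tokenPre, dictAddr, run_ite, run_skip, run_block_nil, run_block_cons, run_assign, eval_reg,
    eval_load, eval_const, eval_mul, eval_add, eval_sub, h0, h1, h2, memOf_even]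
  split_ifs <;> rfl

theorem run_tokenPost :
    tokenPost.run (st [l.length, n, T, Y, W, pos, cur, op, a, b, q, v] m) =
      st [l.length, n, T, Y, W, pos + 3, cur, 0, 0, 0, q, v] m := by
  simp [tokenPost, run_block_nil, run_block_cons, run_assign, eval_reg, eval_const, eval_add]

theorem run_outputPre :
    outputPre.run (st [l.length, n, T, Y, W, pos, cur, op, a, b, q, v] (memOf l d t)) =
      st [l.length, n, T, Y, W, pos, cur, n + 1, a, b, q, t (cur + (W - 1))] (memOf l d t) := by
  simp [outputPre, entry, entryAddr, run_block_nil, run_block_cons, run_assign, eval_reg,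
    eval_load, eval_const, eval_mul, eval_add, eval_sub, memOf_odd]

theorem run_outputBody :
    outputBody.run (st [l.length, n, T, Y, W, pos, cur, op, a, b, q, v] m) =
      st [l.length, n, T, Y, W, pos, cur, op - 1, a + 1, b, q, v / (Y * T * T)]
        (Function.update m a (v % T)) := by
  simp [outputBody, run_block_nil, run_block_cons, run_assign, run_store, eval_reg, eval_const,
    eval_mul, eval_add, eval_sub, eval_div, eval_mod]

end Run

theorem loopFree_initProg : initProg.LoopFree := by simp [initProg, Prog.block, Prog.LoopFree]
theorem loopFree_powBody : powBody.LoopFree := by simp [powBody, Prog.block, Prog.LoopFree]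
theorem loopFree_rewindProg : rewindProg.LoopFree := trivial
theorem loopFree_dictBody : dictBody.LoopFree := by
  simp [dictBody, register, Prog.block, Prog.LoopFree]
theorem loopFree_tokenPre : tokenPre.LoopFree := by simp [tokenPre, Prog.block, Prog.LoopFree]
theorem loopFree_entryBody : entryBody.LoopFree := by simp [entryBody, Prog.block, Prog.LoopFree]
theorem loopFree_tokenPost : tokenPost.LoopFree := by simp [tokenPost, Prog.block, Prog.LoopFree]
theorem loopFree_outputPre : outputPre.LoopFree := by simp [outputPre, Prog.block, Prog.LoopFree]
theorem loopFree_outputBody : outputBody.LoopFree := by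
  simp [outputBody, Prog.block, Prog.LoopFree]

end RAM

/-! ### Correctness and running time of the loops -/

namespace RAM

/-- The list `l` contains the list `s` from the position `pos` on. -/
def Segment (l : List ℕ) (pos : ℕ) (s : List ℕ) : Prop :=
  ∃ u v, l = u ++ s ++ v ∧ u.length = pos

theorem Segment.left {l s s' : List ℕ} {pos : ℕ} (h : Segment l pos (s ++ s')) :
    Segment l pos s := by
  obtain ⟨u, v, h, hu⟩ := h
  exact ⟨u, s' ++ v, by simp [h], hu⟩

theorem Segment.right {l s s' : List ℕ} {pos : ℕ} (h : Segment l pos (s ++ s')) :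
    Segment l (pos + s.length) s' := by
  obtain ⟨u, v, h, hu⟩ := h
  exact ⟨u ++ s, v, by simp [h], by simp [hu]⟩

theorem Segment.length_le {l s : List ℕ} {pos : ℕ} (h : Segment l pos s) :
    pos + s.length ≤ l.length := by
  obtain ⟨u, v, rfl, rfl⟩ := h
  simp

theorem Segment.getD {l s : List ℕ} {pos : ℕ} (h : Segment l pos s) (i : ℕ) (hi : i < s.length) :
    l.getD (pos + i) 0 = s.getD i 0 := by
  obtain ⟨u, v, rfl, rfl⟩ := h
  rw [List.append_assoc, List.getD_append_right _ _ _ _ (Nat.le_add_right _ _),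
    Nat.add_sub_cancel_left, List.getD_append _ _ _ _ hi]

section Loop

variable (e : Expr) (p : Prog) (hp : p.LoopFree)
include hp

theorem exists_iter_le : ∃ C, ∀ (s : State) (b : ℕ), s.Bounded b → e.eval s ≠ 0 →
    Iter e p s (p.run s) (C * (b + 1) ^ 2) := by
  obtain ⟨C, hC⟩ := p.exists_run_le hp
  obtain ⟨D, hD⟩ := e.exists_cost_le
  refine ⟨C + D + 1, fun s b hs he => .step he (hC s b hs).2 (.refl _ 0) ?_⟩
  have h1 := (hD s b hs).2
  have h2 : 1 ≤ (b + 1) ^ 2 := Nat.one_le_pow _ _ (by omega)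
  nlinarith

theorem exists_loop_le : ∃ C, ∀ (f : ℕ → State) (m b : ℕ), (∀ i ≤ m, (f i).Bounded b) →
    (∀ i < m, e.eval (f i) ≠ 0 ∧ p.run (f i) = f (i + 1)) → e.eval (f m) = 0 →
    ExecLE (.loop e p) (f 0) (f m) (C * ((m + 1) * (b + 1) ^ 2)) := by
  obtain ⟨C, hC⟩ := p.exists_run_le hp
  obtain ⟨D, hD⟩ := e.exists_cost_le
  refine ⟨2 * (C + D + 1), fun f m b hb hf he => ?_⟩
  have h2 : 1 ≤ (b + 1) ^ 2 := Nat.one_le_pow _ _ (by omega)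
  have hcost : ∀ i ≤ m, e.cost (f i) + 1 ≤ (C + D + 1) * (b + 1) ^ 2 := by
    intro i hi
    have := (hD (f i) b (hb i hi)).2
    nlinarith
  have h := Iter.of_seq (e := e) (p := p) (m := m) (c := (C + D + 1) * (b + 1) ^ 2) f
    fun i hi => ⟨(hf i hi).1, ?_, hcost i hi.le⟩
  · refine (h.execLE he).mono ?_
    have := hcost m le_rfl
    nlinarith
  · rw [← (hf i hi).2]
    exact (hC (f i) b (hb i hi.le)).2.mono (Nat.mul_le_mul_right _ (by omega))

end Loop

theorem run_register_isDict {A : Finset ℕ} {l : List ℕ} {d t : ℕ → ℕ}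
    {n T Y pos cur op a b q v i : ℕ} {e : Expr} (h : IsDict A d)
    (he : e.eval (st [l.length, n, T, Y, 3 ^ A.card, pos, cur, op, a, b, q, v] (memOf l d t)) = i) :
    ∃ d', IsDict (insert i A) d' ∧
      (register e).run
          (st [l.length, n, T, Y, 3 ^ A.card, pos, cur, op, a, b, q, v] (memOf l d t)) =
        st [l.length, n, T, Y, 3 ^ (insert i A).card, pos, cur, op, a, b, q, v] (memOf l d' t) := by
  rw [run_register l n T Y _ pos cur op a b q v d t e i he]
  split_ifs with hi
  · rw [h.eq_zero_iff] at hi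
    exact ⟨_, h.insert hi, by rw [Finset.card_insert_of_notMem hi, pow_succ']⟩
  · rw [h.eq_zero_iff, not_not] at hi
    exact ⟨d, by rwa [Finset.insert_eq_of_mem hi], by rw [Finset.insert_eq_of_mem hi]⟩

theorem run_dictBody {A : Finset ℕ} {l : List ℕ} {d t : ℕ → ℕ}
    {n T Y pos cur op a b q v x y z : ℕ} (h : IsDict A d) (hs : Segment l pos [x, y, z]) :
    ∃ d', IsDict (if x = 0 then insert y A else if x = 1 then A else insert z (insert y A)) d' ∧
      dictBody.run (st [l.length, n, T, Y, 3 ^ A.card, pos, cur, op, a, b, q, v] (memOf l d t)) =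
        st [l.length, n, T, Y,
          3 ^ (if x = 0 then insert y A else if x = 1 then A else insert z (insert y A)).card,
          pos + 3, cur, op, a, b, q, v] (memOf l d' t) := by
  have hlen : pos + 3 ≤ l.length := hs.length_le
  have h0 : ∀ d, memOf l d t pos = x :=
    fun d => (memOf_left d t (by omega)).trans (hs.getD 0 (by simp))
  have h1 : ∀ d, memOf l d t (pos + 1) = y :=
    fun d => (memOf_left d t (by omega)).trans (hs.getD 1 (by simp))
  have h2 : ∀ d, memOf l d t (pos + 2) = z :=
    fun d => (memOf_left d t (by omega)).trans (hs.getD 2 (by simp))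
  have heval : ∀ (B : Finset ℕ) (d : ℕ → ℕ) (k r : ℕ), memOf l d t (pos + k) = r →
      (Expr.load (.reg 5 + .const k)).eval
        (st [l.length, n, T, Y, 3 ^ B.card, pos, cur, op, a, b, q, v] (memOf l d t)) = r :=
    fun _ _ _ _ h => h
  have heval0 : ∀ (B : Finset ℕ) (d : ℕ → ℕ), (Expr.load (.reg 5)).eval
        (st [l.length, n, T, Y, 3 ^ B.card, pos, cur, op, a, b, q, v] (memOf l d t)) = x :=
    fun _ d => h0 d
  have hpos : ∀ (B : Finset ℕ) (d : ℕ → ℕ), (Prog.assign 5 (.reg 5 + .const 3)).run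
        (st [l.length, n, T, Y, 3 ^ B.card, pos, cur, op, a, b, q, v] (memOf l d t)) =
      st [l.length, n, T, Y, 3 ^ B.card, pos + 3, cur, op, a, b, q, v] (memOf l d t) := by
    intro B d
    rw [run_assign _ _ (by simp)]
    rfl
  obtain ⟨d1, hd1, hr1⟩ := run_register_isDict h (heval A d 1 y (h1 d))
  obtain ⟨d2, hd2, hr2⟩ := run_register_isDict hd1 (heval _ d1 2 z (h2 d1))
  rcases Nat.lt_trichotomy x 1 with hx | hx | hx
  · obtain rfl : x = 0 := by omega
    refine ⟨d1, by simpa using hd1, ?_⟩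
    simp only [dictBody, run_block_cons, run_block_nil, run_ite, run_skip, eval_add, eval_sub,
      eval_const, heval0, hr1]
    simp [heval0, hpos]
  · subst hx
    refine ⟨d, by simpa using h, ?_⟩
    simp only [dictBody, run_block_cons, run_block_nil, run_ite, run_skip, eval_add, eval_sub,
      eval_const, heval0]
    simp [heval0, hpos]
  · have hx0 : x ≠ 0 := by omega
    have hx1 : x ≠ 1 := by omega
    have hx2 : x - 1 ≠ 0 := by omega
    have hx3 : x - 1 + (1 - x) ≠ 0 := by omega
    refine ⟨d2, by simpa [hx0, hx1] using hd2, ?_⟩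
    simp only [dictBody, run_block_cons, run_block_nil, run_ite, run_skip, eval_add, eval_sub,
      eval_const, heval0, hr1, hr2, hpos, if_neg hx0, if_neg hx1, if_neg hx2, if_neg hx3]

theorem eval_moreTokens_ne_zero {l : List ℕ} {R : List ℕ} {m : ℕ → ℕ} {n T Y W pos : ℕ}
    (h : pos < l.length) : moreTokens.eval (st (l.length :: n :: T :: Y :: W :: pos :: R) m) ≠ 0 :=
  Nat.sub_ne_zero_of_lt h

theorem eval_moreTokens_eq_zero {L : ℕ} {R : List ℕ} {m : ℕ → ℕ} {n T Y W : ℕ} :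
    moreTokens.eval (st (L :: n :: T :: Y :: W :: L :: R) m) = 0 :=
  Nat.sub_self L

/-- Simple bounds that hold throughout a run of the program. -/
structure Params (l : List ℕ) (n T Y W b : ℕ) : Prop where
  input : ∀ x ∈ l, Nat.size x ≤ b
  length : Nat.size l.length ≤ b
  n_le : Nat.size n ≤ b
  T_le : Nat.size T ≤ b
  Y_le : Nat.size Y ≤ b
  W_le : Nat.size W ≤ b

/-- `A` collects the labels met so far and grows along the postfix order, while `B` only bounds the
weights uniformly. -/
theorem exists_dict_iter : ∃ C, ∀ (l : List ℕ) (n T Y b : ℕ) (B : Finset ℕ),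
    Params l n T Y (3 ^ B.card) b → ∀ {N : ℕ} (φ : CWExpr (Fin N)) (pos : ℕ) (d : ℕ → ℕ)
      (A : Finset ℕ), IsDict A d → A ∪ φ.labels ⊆ B → Segment l pos φ.encode →
      ∃ d', IsDict (A ∪ φ.labels) d' ∧ Iter moreTokens dictBody
        (st [l.length, n, T, Y, 3 ^ A.card, pos, 0, 0, 0, 0, 0, 0] (memOf l d 0))
        (st [l.length, n, T, Y, 3 ^ (A ∪ φ.labels).card, pos + φ.encode.length, 0, 0, 0, 0, 0, 0]
          (memOf l d' 0)) (φ.numOps * (C * (b + 1) ^ 2)) := by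
  obtain ⟨C, hC⟩ := exists_iter_le moreTokens dictBody loopFree_dictBody
  refine ⟨C, fun l n T Y b B hP N φ => ?_⟩
  have key : ∀ (pos : ℕ) (d : ℕ → ℕ) (A : Finset ℕ) (x y z : ℕ), IsDict A d → A ⊆ B →
      Segment l pos [x, y, z] →
      ∃ d', IsDict (if x = 0 then insert y A else if x = 1 then A else insert z (insert y A)) d' ∧
        Iter moreTokens dictBody
          (st [l.length, n, T, Y, 3 ^ A.card, pos, 0, 0, 0, 0, 0, 0] (memOf l d 0))
          (st [l.length, n, T, Y,
            3 ^ (if x = 0 then insert y A else if x = 1 then A else insert z (insert y A)).card,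
            pos + 3, 0, 0, 0, 0, 0, 0] (memOf l d' 0)) (C * (b + 1) ^ 2) := by
    intro pos d A x y z hd hAB hs
    obtain ⟨d', hd', hrun⟩ := run_dictBody (t := 0) (n := n) (T := T) (Y := Y) (cur := 0)
      (op := 0) (a := 0) (b := 0) (q := 0) (v := 0) hd hs
    refine ⟨d', hd', ?_⟩
    rw [← hrun]
    have hlen : pos + 3 ≤ l.length := hs.length_le
    have hA : Nat.size (3 ^ A.card) ≤ b :=
      size_le_of_le (Nat.pow_le_pow_right (by norm_num) (Finset.card_le_card hAB)) hP.W_le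
    have hpos : Nat.size pos ≤ b := size_le_of_le (by omega) hP.length
    refine hC _ _ (st_bounded ?_ (size_memOf_le hP.input ?_ ?_))
      (eval_moreTokens_ne_zero (by omega))
    · simp [hP.length, hP.n_le, hP.T_le, hP.Y_le, hA, hpos]
    · exact fun i => size_le_of_le (hd.le i) hA
    · simp
  induction φ with
  | single i v =>
    intro pos d A hd hAB hs
    obtain ⟨d', hd', h⟩ := key pos d A _ _ _ hd (Finset.union_subset_left hAB) hs
    have h1 : A ∪ (CWExpr.single i v).labels = insert i A := by
      rw [CWExpr.labels, Finset.union_comm, ← Finset.insert_eq]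
    rw [h1]
    refine ⟨d', hd', ?_⟩
    rw [CWExpr.numOps, one_mul]
    exact h
  | union φ ψ ih1 ih2 =>
    intro pos d A hd hAB hs
    rw [CWExpr.labels, ← Finset.union_assoc] at hAB ⊢
    obtain ⟨d1, hd1, h1⟩ := ih1 pos d A hd (Finset.union_subset_left hAB) hs.left.left
    obtain ⟨d2, hd2, h2⟩ := ih2 _ d1 _ hd1 hAB hs.left.right
    obtain ⟨d3, hd3, h3⟩ := key _ d2 _ _ _ _ hd2 hAB hs.right
    refine ⟨d3, hd3, ?_⟩
    have h := (h1.trans h2).trans (by simpa only [List.length_append, add_assoc] using h3)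
    simp only [CWExpr.encode, List.length_append, List.length_cons, List.length_nil, CWExpr.numOps,
      ← add_assoc] at h ⊢
    refine h.mono (le_of_eq ?_)
    ring
  | join i j φ ih | relabel i j φ ih =>
    intro pos d A hd hAB hs
    have h0 : A ∪ ({i, j} ∪ φ.labels) = insert j (insert i (A ∪ φ.labels)) := by
      ext k
      simp only [Finset.mem_union, Finset.mem_insert, Finset.mem_singleton]
      tauto
    rw [CWExpr.labels, h0] at hAB ⊢
    have hAB' := (Finset.subset_insert _ _).trans ((Finset.subset_insert _ _).trans hAB)
    obtain ⟨d1, hd1, h1⟩ := ih pos d A hd hAB' hs.left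
    obtain ⟨d2, hd2, h2⟩ := key _ d1 _ _ _ _ hd1 hAB' hs.right
    refine ⟨d2, hd2, ?_⟩
    have h := h1.trans h2
    simp only [CWExpr.encode, List.length_append, List.length_cons, List.length_nil, CWExpr.numOps,
      ← add_assoc] at h ⊢
    refine h.mono (le_of_eq ?_)
    ring

/-- The array `t`, with the entries `q, …, W - 1` of the table at `base` replaced by those of
`g`. -/
def fill (t : ℕ → ℕ) (base W : ℕ) (g : ℕ → ℕ) (q : ℕ) : ℕ → ℕ :=
  fun x => if base + q ≤ x ∧ x < base + W then g (x - base) else t x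

theorem fill_self (t : ℕ → ℕ) (base W : ℕ) (g : ℕ → ℕ) : fill t base W g W = t :=
  funext fun _ => if_neg (by omega)

theorem fill_of_lt {t : ℕ → ℕ} {base W : ℕ} {g : ℕ → ℕ} {q x : ℕ} (h : x < base + q) :
    fill t base W g q x = t x := if_neg (by omega)

theorem fill_of_le {t : ℕ → ℕ} {base W : ℕ} {g : ℕ → ℕ} {q x : ℕ} (h : base + W ≤ x) :
    fill t base W g q x = t x := if_neg (by omega)

theorem fill_add {t : ℕ → ℕ} {base W : ℕ} {g : ℕ → ℕ} {q i : ℕ} (h : q ≤ i) (hi : i < W) :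
    fill t base W g q (base + i) = g i := by
  rw [fill, if_pos (by omega), Nat.add_sub_cancel_left]

theorem update_fill {t : ℕ → ℕ} {base W : ℕ} {g : ℕ → ℕ} {q : ℕ} (hq : q < W) :
    Function.update (fill t base W g (q + 1)) (base + q) (g q) = fill t base W g q := by
  funext x
  rw [Function.update_apply]
  split_ifs with h
  · rw [h, fill_add le_rfl hq]
  · unfold fill
    exact if_congr (by omega) rfl rfl

theorem size_fill_le {t : ℕ → ℕ} {base W : ℕ} {g : ℕ → ℕ} {b : ℕ} (ht : ∀ x, Nat.size (t x) ≤ b)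
    (hg : ∀ q < W, Nat.size (g q) ≤ b) (q x : ℕ) : Nat.size (fill t base W g q x) ≤ b := by
  unfold fill
  split_ifs with h
  · exact hg _ (by omega)
  · exact ht x

/-- Here `g` is the desired new table. The last hypothesis says that an entry is computed correctly
even though all larger entries of the table have already been replaced. -/
theorem exists_token_iter : ∃ C, ∀ (l : List ℕ) (n T Y W b pos cur cur' : ℕ) (d t g : ℕ → ℕ)
    (x y z : ℕ), Params l n T Y W b → Nat.size cur ≤ b → Nat.size cur' ≤ b →
    (∀ i, Nat.size (d i) ≤ b) → (∀ i, Nat.size (t i) ≤ b) → (∀ q < W, Nat.size (g q) ≤ b) →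
    Segment l pos [x, y, z] →
    (if x = 0 then cur + W else if x - 1 = 0 then cur - W else cur) = cur' →
    (∀ q < W, newEntry T Y W cur' x (d y) (d z) (fill t cur' W g (q + 1)) q = g q) →
    Iter moreTokens tokenBody (st [l.length, n, T, Y, W, pos, cur, 0, 0, 0, 0, 0] (memOf l d t))
      (st [l.length, n, T, Y, W, pos + 3, cur', 0, 0, 0, 0, 0] (memOf l d (fill t cur' W g 0)))
      (C * ((W + 1) * (b + 1) ^ 2)) := by
  obtain ⟨C1, h1⟩ := Prog.exists_run_le tokenPre loopFree_tokenPre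
  obtain ⟨C2, h2⟩ := exists_loop_le (.reg 10) entryBody loopFree_entryBody
  obtain ⟨C3, h3⟩ := Prog.exists_run_le tokenPost loopFree_tokenPost
  obtain ⟨C4, h4⟩ := moreTokens.exists_cost_le
  refine ⟨C1 + C2 + C3 + C4 + 2, fun l n T Y W b pos cur cur' d t g x y z hP hcur hcur' hd ht hg hs
    heq hnew => ?_⟩
  have hlen : pos + 3 ≤ l.length := hs.length_le
  have hpos : Nat.size pos ≤ b := size_le_of_le (by omega) hP.length
  have hx : Nat.size x ≤ b := by
    obtain ⟨u, v, rfl, -⟩ := hs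
    exact hP.input x (by simp)
  have hs0 : (st [l.length, n, T, Y, W, pos, cur, 0, 0, 0, 0, 0] (memOf l d t)).Bounded b :=
    st_bounded (by simp [hP.length, hP.n_le, hP.T_le, hP.Y_le, hP.W_le, hpos, hcur])
      (size_memOf_le hP.input hd ht)
  -- The state after `i` rounds, when the `i` largest entries have been replaced.
  let f : ℕ → State := fun i => st [l.length, n, T, Y, W, pos, cur', x, d y, d z, W - i, 0]
    (memOf l d (fill t cur' W g (W - i)))
  have hf : ∀ i ≤ W, (f i).Bounded b := by
    intro i _
    have : Nat.size (W - i) ≤ b := size_le_of_le (Nat.sub_le _ _) hP.W_le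
    exact st_bounded (by simp [hP.length, hP.n_le, hP.T_le, hP.Y_le, hP.W_le, hpos, hcur', hd, hx,
      this]) (size_memOf_le hP.input hd (size_fill_le ht hg _))
  have e1 := (h1 _ b hs0).2
  rw [run_tokenPre (x := x) (y := y) (z := z) _ _ _ _ _ pos _ _ _ (by omega) (hs.getD 0 (by simp))
    (hs.getD 1 (by simp)) (hs.getD 2 (by simp)), heq] at e1
  have e2 := h2 f W b hf (fun i hi => ⟨by simp only [f, eval_reg]; simp; omega, ?_⟩)
    (by simp [f, eval_reg])
  · have e3 := (h3 _ b (hf W le_rfl)).2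
    simp only [f, Nat.sub_zero, Nat.sub_self, fill_self] at e2 e3
    rw [run_tokenPost] at e3
    have e4 : ExecLE .skip (st [l.length, n, T, Y, W, pos + 3, cur', 0, 0, 0, 0, 0]
      (memOf l d (fill t cur' W g 0))) _ 1 := ⟨1, le_rfl, .skip _⟩
    refine .step (eval_moreTokens_ne_zero (by omega)) (e1.seq (e2.seq (e3.seq e4))) (.refl _ 0) ?_
    have h5 := (h4 _ b hs0).2
    have h6 : 1 ≤ (b + 1) ^ 2 := Nat.one_le_pow _ _ (by omega)
    have h7 : (b + 1) ^ 2 ≤ (W + 1) * (b + 1) ^ 2 := Nat.le_mul_of_pos_left _ (by omega)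
    generalize (b + 1) ^ 2 = U at *
    generalize (W + 1) * U = U' at *
    have := Nat.mul_le_mul_left C1 h7
    have := Nat.mul_le_mul_left C3 h7
    have := Nat.mul_le_mul_left C4 h7
    simp only [add_mul]
    omega
  · obtain ⟨q, hq⟩ : ∃ q, W - i = q + 1 := ⟨W - i - 1, by omega⟩
    have hq' : W - (i + 1) = q := by omega
    simp only [f, hq, hq']
    rw [run_entryBody, hnew q (by omega), update_fill (by omega)]

/-- Evaluating a subexpression pushes its table and leaves everything below untouched. In a union
this protects the left table while the right one is computed. The stack never holds more tables than
there are operations, which bounds the addresses. -/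
theorem exists_table_iter : ∃ C, ∀ (l : List ℕ) (n T Y b N : ℕ) (B : Finset ℕ) (d : ℕ → ℕ),
    Params l n T Y (3 ^ B.card) b → IsDict B d →
    (∀ χ : CWExpr (Fin N), χ.WellFormed → ∀ z, Nat.size (χ.table T Y z) ≤ b) →
    ∀ (φ : CWExpr (Fin N)) (pos cur : ℕ) (t : ℕ → ℕ), φ.WellFormed → φ.labels ⊆ B →
      Segment l pos φ.encode → (∀ x, Nat.size (t x) ≤ b) →
      Nat.size (cur + 3 ^ B.card * φ.numOps) ≤ b →
      ∃ t', (∀ x, Nat.size (t' x) ≤ b) ∧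
        (∀ q < 3 ^ B.card, t' (cur + 3 ^ B.card + q) = φ.table T Y (labelStates d q)) ∧
        (∀ x < cur + 3 ^ B.card, t' x = t x) ∧
        Iter moreTokens tokenBody
          (st [l.length, n, T, Y, 3 ^ B.card, pos, cur, 0, 0, 0, 0, 0] (memOf l d t))
          (st [l.length, n, T, Y, 3 ^ B.card, pos + φ.encode.length, cur + 3 ^ B.card,
            0, 0, 0, 0, 0]
            (memOf l d t')) (φ.numOps * (C * ((3 ^ B.card + 1) * (b + 1) ^ 2))) := by
  obtain ⟨C, hC⟩ := exists_token_iter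
  refine ⟨C, fun l n T Y b N B d hP hB hF φ => ?_⟩
  have hd : ∀ i, Nat.size (d i) ≤ b := fun i => size_le_of_le (hB.le i) hP.W_le
  generalize hW : 3 ^ B.card = W at *
  have hpos : ∀ φ : CWExpr (Fin N), 1 ≤ φ.numOps := fun φ => by
    cases φ <;> simp [CWExpr.numOps]
  induction φ with
  | single i v =>
    intro pos cur t hφ hlab hs ht hcur
    rw [CWExpr.numOps, mul_one] at hcur
    have hi : i ∈ B := hlab (Finset.mem_singleton_self i)
    have h := hC l n T Y W b pos cur (cur + W) d t
      (fun q => (CWExpr.single i v).table T Y (labelStates d q)) 0 i v hP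
      (size_le_of_le (Nat.le_add_right _ _) hcur) hcur hd ht (fun q _ => hF _ hφ _) hs (if_pos rfl)
      fun q _ => ?_
    · refine ⟨_, size_fill_le ht (fun q _ => hF _ hφ _) _, fun q hq => fill_add (Nat.zero_le _) hq,
        fun x hx => fill_of_lt hx, ?_⟩
      rw [CWExpr.numOps, one_mul]
      exact h
    · rw [newEntry, if_pos rfl, CWExpr.table_single, labelStates]
      have : q / d i % 3 < 3 := Nat.mod_lt _ (by norm_num)
      generalize q / d i % 3 = r at *
      interval_cases r <;> simp
  | union φ ψ ih1 ih2 =>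
    intro pos cur t hφ hlab hs ht hcur
    have h1 := Nat.mul_le_mul_left W (hpos φ)
    have h2 := Nat.mul_le_mul_left W (hpos ψ)
    rw [CWExpr.numOps, mul_add, mul_add, mul_one] at hcur
    obtain ⟨t1, ht1, htab1, hlow1, hit1⟩ := ih1 pos cur t hφ.1
      (Finset.union_subset_left hlab) hs.left.left ht (size_le_of_le (by omega) hcur)
    obtain ⟨t2, ht2, htab2, hlow2, hit2⟩ := ih2 _ (cur + W) t1 hφ.2.1
      (Finset.union_subset_right hlab) hs.left.right ht1 (size_le_of_le (by omega) hcur)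
    have h := hC l n T Y W b _ (cur + W + W) (cur + W) d t2
      (fun q => (CWExpr.union φ ψ).table T Y (labelStates d q)) 1 0 0 hP
      (size_le_of_le (by omega) hcur) (size_le_of_le (by omega) hcur) hd ht2
      (fun q _ => hF _ hφ _) hs.right (by simp) fun q hq => ?_
    · refine ⟨_, size_fill_le ht2 (fun q _ => hF _ hφ _) _,
        fun q hq => fill_add (Nat.zero_le _) hq, fun x hx => ?_, ?_⟩
      · rw [fill_of_lt (by omega), hlow2 x (by omega), hlow1 x hx]
      · have h := (hit1.trans hit2).trans (by simpa only [List.length_append, add_assoc] using h)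
        simp only [CWExpr.encode, List.length_append, List.length_cons, List.length_nil,
          CWExpr.numOps, ← add_assoc] at h ⊢
        refine h.mono (le_of_eq ?_)
        ring
    · rw [newEntry, if_neg one_ne_zero, if_pos rfl, fill_of_lt (by omega), fill_of_le (by omega),
        hlow2 _ (by omega), htab1 q hq, ← add_assoc, htab2 q hq, CWExpr.table_union hφ.2.2]
  | join i j φ ih =>
    intro pos cur t hφ hlab hs ht hcur
    rw [CWExpr.numOps, mul_add, mul_one] at hcur
    have h1 := Nat.mul_le_mul_left W (hpos φ)
    have hi : i ∈ B := hlab (Finset.mem_union_left _ (by simp))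
    have hj : j ∈ B := hlab (Finset.mem_union_left _ (by simp))
    obtain ⟨t1, ht1, htab1, hlow1, hit1⟩ := ih pos cur t hφ.1
      (Finset.union_subset_right hlab) hs.left ht (size_le_of_le (by omega) hcur)
    have h := hC l n T Y W b _ (cur + W) (cur + W) d t1
      (fun q => (CWExpr.join i j φ).table T Y (labelStates d q)) 2 i j hP
      (size_le_of_le (by omega) hcur) (size_le_of_le (by omega) hcur) hd ht1
      (fun q _ => hF _ hφ _) hs.right (by simp) fun q hq => ?_
    · refine ⟨_, size_fill_le ht1 (fun q _ => hF _ hφ _) _,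
        fun q hq => fill_add (Nat.zero_le _) hq, fun x hx => ?_, ?_⟩
      · rw [fill_of_lt (by omega), hlow1 x hx]
      · have h := hit1.trans h
        simp only [CWExpr.encode, List.length_append, List.length_cons, List.length_nil,
          CWExpr.numOps, ← add_assoc] at h ⊢
        refine h.mono (le_of_eq ?_)
        ring
    -- All entries that a join needs have index at most `q`, so they still hold the old table.
    · have hread : ∀ p ≤ q, fill t1 (cur + W)
          W (fun q => (CWExpr.join i j φ).table T Y (labelStates d q)) (q + 1) (cur + W + p) =
            φ.table T Y (labelStates d p) := fun p hp => by
        rw [fill_of_lt (by omega), htab1 p (by omega)]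
      have hij := hφ.2
      have hdi := digit_mul_le q (d i)
      have hdj := digit_mul_le q (d j)
      have zi := hB.labelStates_sub hi q
      have zj := hB.labelStates_sub hj q
      -- Clearing the digit of `i` does not affect the digit of `j`, which the program reads from
      -- the original index.
      have hij' : (q - q / d i % 3 * d i) / d j % 3 = q / d j % 3 := by
        have := congrFun zi j
        rwa [Function.update_of_ne hij.symm] at this
      have zij := hB.labelStates_sub hj (q - q / d i % 3 * d i)
      rw [hij', zi] at zij
      rw [newEntry, if_neg two_ne_zero, if_neg (by norm_num), if_pos rfl, CWExpr.table_join hij,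
        hread _ (Nat.sub_le _ _), hread _ (Nat.sub_le _ _),
        hread (q - q / d i % 3 * d i - q / d j % 3 * d j) (by omega), zi, zj, zij]
      congr 1
      have hi3 : q / d i % 3 < 3 := Nat.mod_lt _ (by norm_num)
      have hj3 : q / d j % 3 < 3 := Nat.mod_lt _ (by norm_num)
      split_ifs with h22
      · simp only [labelStates] at h22
        have hle : q / d i % 3 * d i + q / d j % 3 * d j ≤ q := by
          have := digit_mul_le (q - q / d i % 3 * d i) (d j)
          rw [hij'] at this
          omega
        have z01 := hB.labelStates_add hj
          (q := q - q / d i % 3 * d i - q / d j % 3 * d j) (c := 1) (by rw [zij]; simp)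
          (by norm_num)
        have z10 := hB.labelStates_add hi
          (q := q - q / d i % 3 * d i - q / d j % 3 * d j) (c := 1)
          (by rw [zij]; simp [Function.update_of_ne hij]) (by norm_num)
        have z11 := hB.labelStates_add hj
          (q := q - q / d i % 3 * d i - q / d j % 3 * d j + 1 * d i) (c := 1)
          (by rw [z10, zij]; simp [Function.update_of_ne hij.symm]) (by norm_num)
        rw [z10] at z11
        rw [zij] at z01 z10 z11
        rw [Function.update_idem] at z01
        rw [Function.update_comm hij, Function.update_idem, Function.update_comm hij.symm] at z10
        rw [Function.update_comm hij 0 0, Function.update_idem, Function.update_comm hij.symm,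
          Function.update_idem] at z11
        simp only [one_mul] at z01 z10 z11
        rw [hread _ (by rw [h22.1, h22.2] at *; omega), hread _ (by rw [h22.1, h22.2] at *; omega),
          hread _ (by rw [h22.1, h22.2] at *; omega), z01, z10, z11, h22.1, h22.2]
        norm_num
      · have : q / d i % 3 / 2 * (q / d j % 3 / 2) = 0 := by
          simp only [labelStates] at h22
          rw [mul_eq_zero]
          omega
        rw [this, zero_mul]
  | relabel i j φ ih =>
    intro pos cur t hφ hlab hs ht hcur
    rw [CWExpr.numOps, mul_add, mul_one] at hcur
    have h1 := Nat.mul_le_mul_left W (hpos φ)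
    have hi : i ∈ B := hlab (Finset.mem_union_left _ (by simp))
    obtain ⟨t1, ht1, htab1, hlow1, hit1⟩ := ih pos cur t hφ.1
      (Finset.union_subset_right hlab) hs.left ht (size_le_of_le (by omega) hcur)
    have h := hC l n T Y W b _ (cur + W) (cur + W) d t1
      (fun q => (CWExpr.relabel i j φ).table T Y (labelStates d q)) 3 i j hP
      (size_le_of_le (by omega) hcur) (size_le_of_le (by omega) hcur) hd ht1
      (fun q _ => hF _ hφ _) hs.right (by simp) fun q hq => ?_
    · refine ⟨_, size_fill_le ht1 (fun q _ => hF _ hφ _) _,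
        fun q hq => fill_add (Nat.zero_le _) hq, fun x hx => ?_, ?_⟩
      · rw [fill_of_lt (by omega), hlow1 x hx]
      · have h := hit1.trans h
        simp only [CWExpr.encode, List.length_append, List.length_cons, List.length_nil,
          CWExpr.numOps, ← add_assoc] at h ⊢
        refine h.mono (le_of_eq ?_)
        ring
    · have hij := hφ.2
      have zi := hB.labelStates_sub hi q
      have hz0 : labelStates d (q - q / d i % 3 * d i) i = 0 := by rw [zi]; simp
      have hj3 : q / d j % 3 < 3 := Nat.mod_lt _ (by norm_num)
      have zij := hB.labelStates_add hi hz0 hj3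
      have hlt := hB.add_lt hi hz0 hj3 (by omega)
      rw [hW] at hlt
      rw [zi, Function.update_idem] at zij
      have hj : q / d j % 3 = labelStates d q j := rfl
      rw [newEntry, if_neg (by norm_num), if_neg (by norm_num), if_neg (by norm_num),
        CWExpr.table_relabel]
      -- The entry read may lie above `q` and thus be new already. Its assignment gives `i` and `j`
      -- the same state, and relabeling does not change such entries.
      rcases Nat.lt_or_ge q (q - q / d i % 3 * d i + q / d j % 3 * d i) with h' | h'
      · rw [fill_add h' hlt, CWExpr.table_relabel, zij, Function.update_of_ne hij.symm, hj,
          Function.update_idem]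
      · rw [fill_of_lt (by omega), htab1 _ hlt, zij, hj]

end RAM

/-! ### The whole program and the final bounds -/

namespace RAM

theorem size_pow_le (k : ℕ) : Nat.size (2 ^ k) ≤ k + 1 := Nat.size_pow.le

theorem size_le_self (k : ℕ) : Nat.size k ≤ k := Nat.size_le.2 Nat.lt_two_pow_self

theorem exists_countProg_le : ∃ C, ∀ (l : List ℕ) (n b M : ℕ) (φ : CWExpr (Fin n)),
    φ.WellFormed → l.getD 0 0 = n → Segment l (n * n + 1) φ.encode →
    l.length = n * n + 1 + φ.encode.length →
    Params l n (2 ^ (n + 1)) (2 ^ (n + 1) ^ 2) (3 ^ φ.width) b →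
    (∀ χ : CWExpr (Fin n), χ.WellFormed → ∀ z,
      Nat.size (χ.table (2 ^ (n + 1)) (2 ^ (n + 1) ^ 2) z) ≤ b) →
    Nat.size (3 ^ φ.width * φ.numOps) ≤ b → n ≤ M → φ.numOps ≤ M →
    ∃ s, ExecLE countProg (start l) s (C * (3 ^ φ.width * ((M + 1) * (b + 1) ^ 2))) ∧
      ∀ i ≤ n, s.mem i = φ.table (2 ^ (n + 1)) (2 ^ (n + 1) ^ 2) (fun _ => 2) /
        (2 ^ (n + 1) ^ 2 * 2 ^ (n + 1) * 2 ^ (n + 1)) ^ i % 2 ^ (n + 1) := by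
  obtain ⟨C1, h1⟩ := Prog.exists_run_le initProg loopFree_initProg
  obtain ⟨C2, h2⟩ := exists_loop_le (.reg 7) powBody loopFree_powBody
  obtain ⟨C3, h3⟩ := Prog.exists_run_le rewindProg loopFree_rewindProg
  obtain ⟨C4, h4⟩ := exists_dict_iter
  obtain ⟨C5, h5⟩ := exists_table_iter
  obtain ⟨C6, h6⟩ := Prog.exists_run_le outputPre loopFree_outputPre
  obtain ⟨C7, h7⟩ := exists_loop_le (.reg 7) outputBody loopFree_outputBody
  obtain ⟨C8, h8⟩ := moreTokens.exists_cost_le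
  refine ⟨C1 + C2 + 2 * C3 + C4 + 2 * C5 + C6 + 2 * C7 + 2 * C8 + 3,
    fun l n b M φ hφ hn hs hlen hP hF hW hnM hopsM => ?_⟩
  have hU : 1 ≤ (b + 1) ^ 2 := Nat.one_le_pow _ _ (by omega)
  have hwidth : φ.labels.card = φ.width := rfl
  have hlen0 : 0 < l.length := by omega
  have hnlen : n + 1 ≤ l.length := by have := Nat.le_mul_self n; omega
  have hW1 : 1 ≤ 3 ^ φ.width := Nat.one_le_pow _ _ (by norm_num)
  have hone : Nat.size 1 ≤ b := size_le_of_le hW1 hP.W_le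
  have hmem0 : memOf l 0 0 0 = n := (memOf_left 0 0 hlen0).trans hn
  have hzero : ∀ x : ℕ, Nat.size ((0 : ℕ → ℕ) x) ≤ b := by simp
  have hm0 := size_memOf_le hP.input hzero hzero
  generalize hT : 2 ^ (n + 1) = T at *
  generalize hY : 2 ^ (n + 1) ^ 2 = Y at *
  -- the start
  have e1 := (h1 _ b (st_bounded (R := l.length :: List.replicate 11 0)
    (by simp [hP.length]) hm0)).2
  rw [run_initProg, hmem0, ← start_eq_st] at e1
  -- the powers of two
  let f : ℕ → State := fun i => st [l.length, n, 2 ^ (i + 1), 2 ^ (i + 1) ^ 2, 1, 0, 0, n - i, 0, 0,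
    0, 0] (memOf l 0 0)
  have e2 := h2 f n b (fun i hi => ?_) (fun i hi => ⟨?_, ?_⟩) (by simp [f, eval_reg])
  rotate_left
  · have hT' : Nat.size (2 ^ (i + 1)) ≤ b :=
      size_le_of_le (Nat.pow_le_pow_right (by norm_num) (by omega)) (hT ▸ hP.T_le)
    have hY' : Nat.size (2 ^ (i + 1) ^ 2) ≤ b :=
      size_le_of_le (Nat.pow_le_pow_right (by norm_num) (Nat.pow_le_pow_left (by omega) 2))
        (hY ▸ hP.Y_le)
    have hi' : Nat.size (n - i) ≤ b := size_le_of_le (Nat.sub_le _ _) hP.n_le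
    refine st_bounded ?_ hm0
    simp only [List.mem_cons, List.not_mem_nil, or_false, forall_eq_or_imp, forall_eq,
      Nat.size_zero, Nat.zero_le, true_and, and_true]
    exact ⟨hP.length, hP.n_le, hT', hY', hone, hi'⟩
  · simp only [f, eval_reg]
    simp
    omega
  · simp only [f]
    rw [run_powBody, ← pow_succ, Nat.sub_sub]
    congr 4
    ring_nf
  simp only [f, Nat.sub_zero, Nat.sub_self, zero_add, pow_one, one_pow, hT, hY] at e2
  have e3 := (h3 (st [l.length, n, T, Y, 1, 0, 0, 0, 0, 0, 0, 0] (memOf l 0 0)) b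
    (st_bounded (by simp [hP.length, hP.n_le, hP.T_le, hP.Y_le, Nat.size_one ▸ hone]) hm0)).2
  rw [run_rewindProg] at e3
  -- the weights of the labels
  obtain ⟨d, hd, hit⟩ := h4 l n T Y b φ.labels hP φ _ 0 ∅ isDict_empty
    (by rw [Finset.empty_union]) hs
  rw [Finset.card_empty, pow_zero, Finset.empty_union, ← hlen, hwidth] at hit
  rw [Finset.empty_union] at hd
  have hsize_d : ∀ i, Nat.size (d i) ≤ b := fun i => size_le_of_le (hd.le i) hP.W_le
  have hb4 := st_bounded (R := [l.length, n, T, Y, 3 ^ φ.width, l.length, 0, 0, 0, 0, 0, 0])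
    (by simp [hP.length, hP.n_le, hP.T_le, hP.Y_le, hP.W_le]) (size_memOf_le hP.input hsize_d hzero)
  have e4 := hit.execLE eval_moreTokens_eq_zero
  have e5 := (h3 _ b hb4).2
  rw [run_rewindProg] at e5
  -- the tables
  obtain ⟨t, ht, htab, -, hit'⟩ := h5 l n T Y b n φ.labels d hP hd hF φ _ 0 0 hφ subset_rfl hs hzero
    (by rw [zero_add]; exact hW)
  -- The last entry has state 2 at every occurring label.
  have hdigits : φ.table T Y (labelStates d (3 ^ φ.width - 1)) = φ.table T Y fun _ => 2 :=
    CWExpr.table_congr fun i hi => labelStates_sub_one hd hi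
  have hv : t (3 ^ φ.width + (3 ^ φ.width - 1)) = φ.table T Y fun _ => 2 := by
    have := htab (3 ^ φ.width - 1) (Nat.sub_lt hW1 one_pos)
    rw [zero_add] at this
    exact this.trans hdigits
  rw [zero_add, ← hlen, hwidth] at hit'
  have hmt := size_memOf_le hP.input hsize_d ht
  have hb6 := st_bounded
    (R := [l.length, n, T, Y, 3 ^ φ.width, l.length, 3 ^ φ.width, 0, 0, 0, 0, 0])
    (by simp [hP.length, hP.n_le, hP.T_le, hP.Y_le, hP.W_le]) hmt
  have e6 := hit'.execLE eval_moreTokens_eq_zero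
  -- the output
  have e7 := (h6 _ b hb6).2
  rw [run_outputPre, hv] at e7
  generalize hv0 : φ.table T Y (fun _ => 2) = v at *
  have hvb : Nat.size v ≤ b := hv0 ▸ hF φ hφ _
  -- The output overwrites the input, which is no longer needed.
  let g : ℕ → State := fun i => st [l.length, n, T, Y, 3 ^ φ.width, l.length, 3 ^ φ.width,
    n + 1 - i, i, 0, 0, v / (Y * T * T) ^ i]
      fun a => if a < i then v / (Y * T * T) ^ a % T else memOf l d t a
  have e8 := h7 g (n + 1) b (fun i hi => ?_) (fun i hi => ⟨?_, ?_⟩) (by simp [g, eval_reg])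
  rotate_left
  · have hi1 : Nat.size (n + 1 - i) ≤ b := size_le_of_le (by omega) hP.length
    have hi2 : Nat.size i ≤ b := size_le_of_le (by omega) hP.length
    have hi3 : Nat.size (v / (Y * T * T) ^ i) ≤ b := size_le_of_le (Nat.div_le_self _ _) hvb
    refine st_bounded (by simp [hP.length, hP.n_le, hP.T_le, hP.Y_le, hP.W_le, hi1, hi2, hi3])
      fun a => ?_
    split_ifs
    · exact size_le_of_le ((Nat.mod_le _ _).trans (Nat.div_le_self _ _)) hvb
    · exact hmt a
  · simp only [g, eval_reg]
    simp
    omega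
  · simp only [g]
    rw [run_outputBody, Nat.sub_sub, Nat.div_div_eq_div_mul, ← pow_succ]
    congr 1
    funext a
    rw [Function.update_apply]
    split_ifs with ha1 ha2 ha3 ha4
    · rw [ha1]
    · omega
    · rfl
    · omega
    · omega
    · rfl
  have hg0 : g 0 = st [l.length, n, T, Y, 3 ^ φ.width, l.length, 3 ^ φ.width, n + 1, 0, 0, 0, v]
      (memOf l d t) := by simp [g]
  rw [hg0] at e8
  have e9 : ExecLE .skip (g (n + 1)) (g (n + 1)) 1 := ⟨1, le_rfl, .skip _⟩
  refine ⟨g (n + 1), ?_, fun i hi => if_pos (by omega)⟩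
  refine (e1.seq (e2.seq (e3.seq (e4.seq (e5.seq (e6.seq (e7.seq (e8.seq e9)))))))).mono ?_
  have c4 := (h8 _ b hb4).2
  have c6 := (h8 _ b hb6).2
  generalize (b + 1) ^ 2 = U at *
  generalize 3 ^ φ.width = W at *
  have x0 : U ≤ W * ((M + 1) * U) := by
    simpa using Nat.mul_le_mul hW1 (Nat.mul_le_mul_right U (Nat.le_add_left 1 M))
  have x1 : (n + 1) * U ≤ W * ((M + 1) * U) := by
    simpa using Nat.mul_le_mul hW1 (Nat.mul_le_mul_right U (Nat.add_le_add_right hnM 1))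
  have x2 : φ.numOps * U ≤ W * ((M + 1) * U) := by
    simpa using Nat.mul_le_mul hW1 (Nat.mul_le_mul_right U (hopsM.trans (Nat.le_succ M)))
  have x3 : φ.numOps * ((W + 1) * U) ≤ 2 * (W * ((M + 1) * U)) := by
    calc φ.numOps * ((W + 1) * U) ≤ (M + 1) * ((2 * W) * U) :=
          Nat.mul_le_mul (by omega) (Nat.mul_le_mul_right U (by omega))
      _ = _ := by ring
  have x4 : (n + 1 + 1) * U ≤ 2 * (W * ((M + 1) * U)) := by linarith
  have x5 : 1 ≤ W * ((M + 1) * U) := hU.trans x0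
  generalize W * ((M + 1) * U) = X at *
  have y1 := Nat.mul_le_mul_left C1 x0
  have y2 := Nat.mul_le_mul_left C2 x1
  have y3 := Nat.mul_le_mul_left C3 x0
  have y4 := Nat.mul_le_mul_left C4 x2
  have y5 := Nat.mul_le_mul_left C5 x3
  have y6 := Nat.mul_le_mul_left C6 x0
  have y7 := Nat.mul_le_mul_left C7 x4
  have y8 := Nat.mul_le_mul_left C8 x0
  linarith

/-- The bound `2 ^ n * (T ^ n * Y ^ n)` has exponent `n + (n + 1) * n + (n + 1) ^ 2 * n = (n + 1) ^
3 - 1`. -/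
theorem size_table_le {n : ℕ} {φ : CWExpr (Fin n)} (hφ : φ.WellFormed) (z : ℕ → ℕ) :
    Nat.size (φ.table (2 ^ (n + 1)) (2 ^ (n + 1) ^ 2) z) ≤ (n + 1) ^ 3 := by
  have h := φ.table_le (n := n) (T := 2 ^ (n + 1)) (Y := 2 ^ (n + 1) ^ 2) hφ
    (Nat.one_le_pow _ _ (by norm_num)) (Nat.one_le_pow _ _ (by norm_num)) z
    (by simpa using φ.eval.verts.card_le_univ)
  rw [← pow_mul, ← pow_mul, ← pow_add, ← pow_add] at h
  refine (size_le_of_le h (size_pow_le _)).trans (le_of_eq ?_)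
  ring

theorem length_encodeInput {n : ℕ} (G : SimpleGraph (Fin n)) (ψ : CWExpr (Fin n)) :
    (encodeInput G ψ).length = n * n + 1 + ψ.encode.length := by
  simp [encodeInput, List.length_flatMap]
  ring

theorem segment_encodeInput {n : ℕ} (G : SimpleGraph (Fin n)) (ψ : CWExpr (Fin n)) :
    Segment (encodeInput G ψ) (n * n + 1) ψ.encode := by
  refine ⟨_, [], (List.append_nil _).symm, ?_⟩
  have h := length_encodeInput G ψ
  rw [encodeInput, List.length_append] at h
  exact Nat.add_right_cancel h

theorem length_le_bitLength (l : List ℕ) : l.length ≤ bitLength l := by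
  induction l with
  | nil => simp
  | cons a l ih =>
    simp only [bitLength, List.length_cons, List.map_cons, List.sum_cons] at ih ⊢
    omega

theorem size_le_bitLength {l : List ℕ} {x : ℕ} (hx : x ∈ l) : Nat.size x ≤ bitLength l :=
  (Nat.le_succ _).trans
    (List.single_le_sum (by simp) _ (List.mem_map_of_mem (f := fun k => Nat.size k + 1) hx))

end RAM

open RAM in
theorem mainTheorem3 :
    ∃ (p : RAM.Prog) (P : Polynomial ℕ),
      ∀ (n : ℕ) (G : SimpleGraph (Fin n)) (ψ : CWExpr (Fin n)),
        ψ.Describes G → ψ.Irredundant →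
          ∃ (s : RAM.State) (t : ℕ),
            RAM.Exec p (RAM.start (encodeInput G ψ)) s t ∧
            t ≤ 3 ^ ψ.width * P.eval (RAM.bitLength (encodeInput G ψ)) ∧
            ∀ l : ℕ, 2 * l ≤ n → s.mem l = G.numInducedMatchings l := by
  obtain ⟨C, hC⟩ := exists_countProg_le
  -- All numbers that occur between iterations have at most `4 * (N + 1) ^ 3` bits.
  refine ⟨countProg, .C C * ((.X + 1) * (4 * (.X + 1) ^ 3 + 1) ^ 2), fun n G ψ hψ hirr => ?_⟩
  have hlen := length_encodeInput G ψ
  have hbit := length_le_bitLength (encodeInput G ψ)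
  have hinput := fun x => size_le_bitLength (l := encodeInput G ψ) (x := x)
  have hn : (encodeInput G ψ).getD 0 0 = n := by simp [encodeInput]
  have hs := segment_encodeInput G ψ
  generalize bitLength (encodeInput G ψ) = N at *
  generalize encodeInput G ψ = l at *
  have hops := ψ.length_encode
  have hlab := ψ.card_labels_le
  have hnn := Nat.le_mul_self n
  have hN : N + 1 ≤ (N + 1) ^ 3 := Nat.le_self_pow (by norm_num) _
  have hN2 : (N + 1) ^ 2 ≤ (N + 1) ^ 3 := Nat.pow_le_pow_right (by omega) (by norm_num)
  have hn2 : (n + 1) ^ 2 ≤ (N + 1) ^ 2 := Nat.pow_le_pow_left (by omega) 2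
  have hn3 : (n + 1) ^ 3 ≤ (N + 1) ^ 3 := Nat.pow_le_pow_left (by omega) 3
  -- The width is at most twice the number of operations, and each operation takes three input
  -- numbers, so the width is at most `N`; then `3 ≤ 2 ^ 2` is used.
  have hW : 3 ^ ψ.width ≤ 2 ^ (2 * N) := by
    rw [pow_mul]
    exact (Nat.pow_le_pow_left (by norm_num) _).trans
      (Nat.pow_le_pow_right (by norm_num) (by rw [CWExpr.width]; omega))
  have hW' : 3 ^ ψ.width * ψ.numOps ≤ 2 ^ (2 * N + N) := by
    rw [pow_add]
    exact Nat.mul_le_mul hW ((by omega : ψ.numOps ≤ N).trans Nat.lt_two_pow_self.le)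
  have hP : Params l n (2 ^ (n + 1)) (2 ^ (n + 1) ^ 2) (3 ^ ψ.width) (4 * (N + 1) ^ 3) :=
    { input := fun x hx => (hinput x hx).trans (by omega)
      length := (size_le_self _).trans (by omega)
      n_le := (size_le_self _).trans (by omega)
      T_le := (size_pow_le _).trans (by omega)
      Y_le := (size_pow_le _).trans (by omega)
      W_le := size_le_of_le hW ((size_pow_le _).trans (by omega)) }
  obtain ⟨s, ⟨t, ht, hexec⟩, hmem⟩ := hC l n (4 * (N + 1) ^ 3) N ψ hψ.1 hn hs hlen hP
    (fun χ hχ z => (size_table_le hχ z).trans (by omega))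
    (size_le_of_le hW' ((size_pow_le _).trans (by omega))) (by omega) (by omega)
  refine ⟨s, t, hexec, ht.trans (le_of_eq ?_), fun k hk => ?_⟩
  · simp only [Polynomial.eval_mul, Polynomial.eval_C, Polynomial.eval_add, Polynomial.eval_X,
      Polynomial.eval_one, Polynomial.eval_pow, Polynomial.eval_ofNat]
    ring
  · have hY : 2 ^ (n + 1) ^ 2 = (2 ^ (n + 1)) ^ (n + 1) := by rw [← pow_mul, sq]
    have hZ : ((2 ^ (n + 1)) ^ (n + 1) * 2 ^ (n + 1) * 2 ^ (n + 1)) ^ k =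
        (2 ^ (n + 1)) ^ ((n + 3) * k) := by
      rw [← pow_succ, ← pow_succ, ← pow_mul (2 ^ (n + 1))]
    rw [hmem k (by omega), hY, hZ]
    exact CWExpr.table_two_div_mod hψ hirr (Fintype.card_fin n)
      (Nat.pow_lt_pow_right (by norm_num) (Nat.lt_succ_self n)) hk
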